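/- Let $T$ be a finite rooted tree with root $\rho$. Every edge has a cost $\ge 0$ (covering both directions), and every node $v$ has a request probability $\pi_v\in(0,1]$ and a prize $p_v\in\mathbb R$ (a mere bifurcation has $\pi_v=1$, $p_v=-1$). Nodes issue requests independently; $\omega$ denotes the random set of requesting nodes. Let $a$ be a node of $T$, let $A$ be the sub-tree of $T$ rooted at $a$, and let $\delta_a$ be the cost of the path from $\rho$ to $a$. The sub-trees of $A$ are the single-node tree $\{a\}$ and the full sub-trees rooted at the children of $a$; for a group (set) $I$ of sub-trees of $A$ let $V_I$ be the set of nodes they contain. For a set $S$ of nodes of $A$ and a bonus $x\in[0,\delta_a]$ let the profit be $\sum_{s\in S\cap\omega}p_s$ minus the discounted cost, which is $0$ if $S\cap\omega=\emptyset$ and otherwise is $\delta_a-x$ plus the total cost of the edges below $a$ that lie on the path from $a$ to some node of $S\cap\omega$. Let $\bar P(S,x)$ be the expected profit, let $\pi_S$ be the probability that $S\cap\omega\ne\emptyset$, and let $f_I(x)=\max_{S\subseteq V_I}\bar P(S,x)$ be the sub-trees characteristic function of $I$; the maximizers $S$ are the optimal sets of $I$ for the bonus $x$. The description of $f_I$ on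 $[0,\delta_a]$ is the list of records $\langle S_i,x^{\min}_i,x^{\max}_i,\pi_i,q_i\rangle$, $i=0,\dots,n$, such that $x^{\min}_0=0$, $x^{\max}_n=\delta_a$, $x^{\min}_i\le x^{\max}_i$, $x^{\max}_i=x^{\min}_{i+1}$, $x^{\min}_i<x^{\min}_{i+1}$, $S_i\subsetneq S_{i+1}$, $\pi_i<\pi_{i+1}$; $S_i$ is the (inclusion-)maximal optimal set of $I$ for every $x\in[x^{\min}_i,x^{\max}_i)$, and $S_n$ is so also for $x=\delta_a$; $\pi_i=\pi_{S_i}$ and $q_i=\bar P(S_i,\delta_a)$. A description is stored in memory as the number of its records, the four numerical fields of every record, and the chain $S_0\subsetneq\dots\subsetneq S_n$ in the form of one list of distinct nodes together with the lengths $|S_i|$, the first $|S_i|$ entries of the list being the elements of $S_i$. **Proposition.** There are a real-RAM program (unit-cost arithmetic and comparison of reals, unit-cost addition, truncated subtraction and comparison of natural numbers, indexed arrays) and a constant $c$ such that, for all $T$, $\pi$, $p$, edge costs and $a$ as above and any two disjoint groups $B$ and $C$ of sub-trees of $A$, the program, started with the descriptions of $f_B$ and $f_C$ in memory, halts after at most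 $c\,(|V_{B\cup C}|+1)$ steps with the description of $f_{B\cup C}$ in memory. In other words, the description of $f_{B\cup C}$ is computed from those of $f_B$ and $f_C$ in time $O(|V_{B\cup C}|)$. -/

import Mathlib

universe u

/-! ### The problem data

A finite rooted tree is Mathlib's `RootedTree`: `v ≤ w` means that `v` lies on the path from the
root `⊥` to `w`, and `v ⋖ w` means that `v` is the parent of `w`. -/

/-- The data of the probabilistic profitable tour problem on the rooted tree `T`.
For `v ≠ ⊥`, `arc v` is the (two-way) cost of the edge joining `v` to its parent; the value of
`arc` at the root is never used. A bifurcation node is a node with prize `-1` and probability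
`1`. -/
structure TourProblem (T : RootedTree.{u}) where
  arc : T → ℝ
  prob : T → ℝ
  prize : T → ℝ
  arc_nonneg : ∀ v, 0 ≤ arc v
  prob_pos : ∀ v, 0 < prob v
  prob_le_one : ∀ v, prob v ≤ 1

/-- The index set of the sub-trees of the tree rooted at `a`. The index `a` itself stands for the
one-node sub-tree consisting of the root `a`; a child `c` of `a` stands for the sub-tree rooted at
`c`. -/
def subTreeIndices {T : RootedTree.{u}} (a : T) : Set T := {i | i = a ∨ a ⋖ i}

/-- The node set of the sub-tree with index `i` of the tree rooted at `a`. -/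
def subTreeNodes {T : RootedTree.{u}} (a i : T) : Set T := {v | (i = a ∧ v = a) ∨ (a ⋖ i ∧ i ≤ v)}

open Classical in
/-- The set of nodes belonging to the group `I` of sub-trees of the tree rooted at `a`. -/
noncomputable def groupNodes {T : RootedTree.{u}} [Fintype T] (a : T) (I : Finset T) : Finset T :=
  Finset.univ.filter fun v => ∃ i ∈ I, v ∈ subTreeNodes a i

namespace TourProblem

variable {T : RootedTree.{u}} [Fintype T] (P : TourProblem T)

open Classical in
/-- The probability that `ω` is exactly the set of nodes issuing a request. -/
noncomputable def outcomeProb (ω : Finset T) : ℝ :=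
  (∏ v ∈ ω, P.prob v) * ∏ v ∈ Finset.univ \ ω, (1 - P.prob v)

/-- The expected value of a random variable depending on the outcome. -/
noncomputable def expect (X : Finset T → ℝ) : ℝ := ∑ ω : Finset T, X ω * P.outcomeProb ω

open Classical in
/-- The indicator that at least one node of `Q` issues a request. -/
noncomputable def hit (Q ω : Finset T) : ℝ := if (Q ∩ ω).Nonempty then 1 else 0

/-- The probability that at least one node of `S` issues a request. -/
noncomputable def requestProb (S : Finset T) : ℝ := P.expect fun ω => hit S ω

open Classical in
/-- The cost to reach the node `v` from the root of the main tree. -/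
noncomputable def dist (v : T) : ℝ := ∑ w ∈ Finset.univ.filter (fun w => w ≠ ⊥ ∧ w ≤ v), P.arc w

/-- The revenue of the a priori selection `S` under the outcome `ω`. -/
noncomputable def revenue (S ω : Finset T) : ℝ := ∑ s ∈ S, P.prize s * hit {s} ω

open Classical in
/-- The cost of visiting the nodes of `S ∩ ω` starting from `a`: the total cost of the edges below
`a` lying on the path from the root to some node of `S ∩ ω`. -/
noncomputable def costFrom (a : T) (S ω : Finset T) : ℝ :=
  ∑ w ∈ Finset.univ.filter (fun w => a < w ∧ ∃ s ∈ S ∩ ω, w ≤ s), P.arc w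

/-- The discounted cost, with bonus `x`, of a set `S` of nodes of the tree rooted at `a`. -/
noncomputable def cost (a : T) (S : Finset T) (x : ℝ) (ω : Finset T) : ℝ :=
  (P.dist a - x + P.costFrom a S ω) * hit S ω

/-- The expected profit, with bonus `x`, of a set `S` of nodes of the tree rooted at `a`. -/
noncomputable def profit (a : T) (S : Finset T) (x : ℝ) : ℝ :=
  P.expect fun ω => P.revenue S ω - P.cost a S x ω

/-- The sub-trees characteristic function of the group `I` of sub-trees of the tree rooted at `a`:
the maximal expected profit of a set of nodes of the group. -/
noncomputable def charFun (a : T) (I : Finset T) (x : ℝ) : ℝ :=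
  (groupNodes a I).powerset.sup' (Finset.powerset_nonempty _) fun S => P.profit a S x

/-- `S` is an optimal set of the group `I` for the bonus `x`. -/
def IsOptimal (a : T) (I : Finset T) (x : ℝ) (S : Finset T) : Prop :=
  S ⊆ groupNodes a I ∧ P.profit a S x = P.charFun a I x

/-- `S` is a maximal optimal set of the group `I` for the bonus `x`, with respect to inclusion. -/
def IsMaximalOptimal (a : T) (I : Finset T) (x : ℝ) (S : Finset T) : Prop :=
  Maximal (P.IsOptimal a I x) S

end TourProblem

/-! ### Descriptions of characteristic functions -/

/-- A record describing one linear piece: a node set, the endpoints of the range of the piece, the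
slope, and the value of the profit line at the right end of the whole domain. -/
structure PieceRecord (T : RootedTree.{u}) where
  nodes : Finset T
  xmin : ℝ
  xmax : ℝ
  slope : ℝ
  value : ℝ

/-- A list of `n + 1` records. -/
structure Description (T : RootedTree.{u}) where
  n : ℕ
  piece : Fin (n + 1) → PieceRecord T

/-- `D` is the description of the sub-trees characteristic function of the group `I` of sub-trees of
the tree rooted at `a`, on the domain `[0, dist a]`. -/
structure Describes {T : RootedTree.{u}} [Fintype T] (P : TourProblem T) (a : T) (I : Finset T)
    (D : Description T) : Prop where
  first : (D.piece 0).xmin = 0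
  last : (D.piece (Fin.last D.n)).xmax = P.dist a
  range : ∀ i, (D.piece i).xmin ≤ (D.piece i).xmax
  glue : ∀ i : Fin D.n, (D.piece i.castSucc).xmax = (D.piece i.succ).xmin
  xmin_lt : ∀ i : Fin D.n, (D.piece i.castSucc).xmin < (D.piece i.succ).xmin
  nodes_ssubset : ∀ i : Fin D.n, (D.piece i.castSucc).nodes ⊂ (D.piece i.succ).nodes
  slope_lt : ∀ i : Fin D.n, (D.piece i.castSucc).slope < (D.piece i.succ).slope
  maximal : ∀ i, ∀ x ∈ Set.Ico (D.piece i).xmin (D.piece i).xmax,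
    P.IsMaximalOptimal a I x (D.piece i).nodes
  maximal_last : P.IsMaximalOptimal a I (P.dist a) (D.piece (Fin.last D.n)).nodes
  slope_eq : ∀ i, (D.piece i).slope = P.requestProb (D.piece i).nodes
  value_eq : ∀ i, (D.piece i).value = P.profit a (D.piece i).nodes (P.dist a)

/-! ### The machine model: a real random access machine with counted steps

Programs are structured programs over integer registers, real registers, integer arrays and real
arrays, all of them addressed by numerals in the program; array cells are addressed by computed
integers. The elementary operations are addition, truncated subtraction and comparison of natural
numbers, and the four arithmetic operations and comparison of real numbers (with `x / 0 = 0`).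
There is no conversion between the two sorts. -/

namespace RealRAM

/-- The contents of the memory. -/
structure Store where
  nat : ℕ → ℕ
  real : ℕ → ℝ
  natArr : ℕ → ℕ → ℕ
  realArr : ℕ → ℕ → ℝ

/-- Integer expressions. -/
inductive NExp where
  | lit (n : ℕ)
  | reg (r : ℕ)
  | read (arr : ℕ) (idx : NExp)
  | add (e₁ e₂ : NExp)
  | sub (e₁ e₂ : NExp)

/-- Real expressions. -/
inductive RExp where
  | lit (n : ℕ)
  | reg (r : ℕ)
  | read (arr : ℕ) (idx : NExp)
  | add (e₁ e₂ : RExp)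
  | sub (e₁ e₂ : RExp)
  | mul (e₁ e₂ : RExp)
  | div (e₁ e₂ : RExp)

/-- Tests. -/
inductive Test where
  | natLe (e₁ e₂ : NExp)
  | realLe (e₁ e₂ : RExp)
  | neg (b : Test)
  | conj (b₁ b₂ : Test)

/-- Programs. -/
inductive Prog where
  | nop
  | setNat (r : ℕ) (e : NExp)
  | setReal (r : ℕ) (e : RExp)
  | writeNat (arr : ℕ) (idx e : NExp)
  | writeReal (arr : ℕ) (idx : NExp) (e : RExp)
  | seq (p₁ p₂ : Prog)
  | branch (b : Test) (p₁ p₂ : Prog)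
  | loop (b : Test) (p : Prog)

def NExp.eval (σ : Store) : NExp → ℕ
  | .lit n => n
  | .reg r => σ.nat r
  | .read arr idx => σ.natArr arr (idx.eval σ)
  | .add e₁ e₂ => e₁.eval σ + e₂.eval σ
  | .sub e₁ e₂ => e₁.eval σ - e₂.eval σ

noncomputable def RExp.eval (σ : Store) : RExp → ℝ
  | .lit n => n
  | .reg r => σ.real r
  | .read arr idx => σ.realArr arr (idx.eval σ)
  | .add e₁ e₂ => e₁.eval σ + e₂.eval σ
  | .sub e₁ e₂ => e₁.eval σ - e₂.eval σ
  | .mul e₁ e₂ => e₁.eval σ * e₂.eval σ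
  | .div e₁ e₂ => e₁.eval σ / e₂.eval σ

def Test.Holds (σ : Store) : Test → Prop
  | .natLe e₁ e₂ => e₁.eval σ ≤ e₂.eval σ
  | .realLe e₁ e₂ => e₁.eval σ ≤ e₂.eval σ
  | .neg b => ¬ b.Holds σ
  | .conj b₁ b₂ => b₁.Holds σ ∧ b₂.Holds σ

/-- The number of elementary operations needed to evaluate an expression. -/
def NExp.steps : NExp → ℕ
  | .lit _ => 1
  | .reg _ => 1
  | .read _ idx => idx.steps + 1
  | .add e₁ e₂ => e₁.steps + e₂.steps + 1
  | .sub e₁ e₂ => e₁.steps + e₂.steps + 1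

def RExp.steps : RExp → ℕ
  | .lit _ => 1
  | .reg _ => 1
  | .read _ idx => idx.steps + 1
  | .add e₁ e₂ => e₁.steps + e₂.steps + 1
  | .sub e₁ e₂ => e₁.steps + e₂.steps + 1
  | .mul e₁ e₂ => e₁.steps + e₂.steps + 1
  | .div e₁ e₂ => e₁.steps + e₂.steps + 1

def Test.steps : Test → ℕ
  | .natLe e₁ e₂ => e₁.steps + e₂.steps + 1
  | .realLe e₁ e₂ => e₁.steps + e₂.steps + 1
  | .neg b => b.steps + 1
  | .conj b₁ b₂ => b₁.steps + b₂.steps + 1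

/-- `Exec p σ t σ'`: started with memory `σ`, the program `p` halts after `t` steps with memory
`σ'`. -/
inductive Exec : Prog → Store → ℕ → Store → Prop
  | nop (σ : Store) : Exec .nop σ 1 σ
  | setNat (σ : Store) (r : ℕ) (e : NExp) :
      Exec (.setNat r e) σ (e.steps + 1) { σ with nat := Function.update σ.nat r (e.eval σ) }
  | setReal (σ : Store) (r : ℕ) (e : RExp) :
      Exec (.setReal r e) σ (e.steps + 1) { σ with real := Function.update σ.real r (e.eval σ) }
  | writeNat (σ : Store) (arr : ℕ) (idx e : NExp) :
      Exec (.writeNat arr idx e) σ (idx.steps + e.steps + 1)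
        { σ with
          natArr := Function.update σ.natArr arr
            (Function.update (σ.natArr arr) (idx.eval σ) (e.eval σ)) }
  | writeReal (σ : Store) (arr : ℕ) (idx : NExp) (e : RExp) :
      Exec (.writeReal arr idx e) σ (idx.steps + e.steps + 1)
        { σ with
          realArr := Function.update σ.realArr arr
            (Function.update (σ.realArr arr) (idx.eval σ) (e.eval σ)) }
  | seq {p₁ p₂ : Prog} {σ σ₁ σ₂ : Store} {t₁ t₂ : ℕ} :
      Exec p₁ σ t₁ σ₁ → Exec p₂ σ₁ t₂ σ₂ → Exec (.seq p₁ p₂) σ (t₁ + t₂) σ₂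
  | branchTrue {b : Test} {p₁ p₂ : Prog} {σ σ' : Store} {t : ℕ} :
      b.Holds σ → Exec p₁ σ t σ' → Exec (.branch b p₁ p₂) σ (b.steps + 1 + t) σ'
  | branchFalse {b : Test} {p₁ p₂ : Prog} {σ σ' : Store} {t : ℕ} :
      ¬ b.Holds σ → Exec p₂ σ t σ' → Exec (.branch b p₁ p₂) σ (b.steps + 1 + t) σ'
  | loopTrue {b : Test} {p : Prog} {σ σ₁ σ₂ : Store} {t₁ t₂ : ℕ} :
      b.Holds σ → Exec p σ t₁ σ₁ → Exec (.loop b p) σ₁ t₂ σ₂ →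
        Exec (.loop b p) σ (b.steps + 1 + t₁ + t₂) σ₂
  | loopFalse {b : Test} {p : Prog} {σ : Store} :
      ¬ b.Holds σ → Exec (.loop b p) σ (b.steps + 1) σ

/-- The description `D` is stored in the `k`-th slot of the memory, nodes being represented by the
numbers `label v`. The number of records is in the integer register `k`; the numerical fields of the
records are in the real arrays `4 k, …, 4 k + 3`. The node sets, which form a chain, are stored as
prefixes of one list of nodes: the integer array `2 k + 1` lists the nodes without repetition, and
the `i`-th entry of the integer array `2 k` is the length of the prefix that forms the `i`-th set. -/
structure Stores {T : RootedTree.{u}} (label : T ↪ ℕ) (σ : Store) (k : ℕ) (D : Description T) :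
    Prop where
  count : σ.nat k = D.n + 1
  xmin : ∀ i : Fin (D.n + 1), σ.realArr (4 * k) i = (D.piece i).xmin
  xmax : ∀ i : Fin (D.n + 1), σ.realArr (4 * k + 1) i = (D.piece i).xmax
  slope : ∀ i : Fin (D.n + 1), σ.realArr (4 * k + 2) i = (D.piece i).slope
  value : ∀ i : Fin (D.n + 1), σ.realArr (4 * k + 3) i = (D.piece i).value
  card : ∀ i : Fin (D.n + 1), σ.natArr (2 * k) i = (D.piece i).nodes.card
  nodes : ∀ i : Fin (D.n + 1), (Finset.range (D.piece i).nodes.card).image (σ.natArr (2 * k + 1)) =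
    (D.piece i).nodes.map label

end RealRAM

/-! Write δ for the cost of reaching `a`. The profit of a set S is affine in the bonus x, with slope
the request probability π_S (`profit_eq`), and supermodular in S (`profit_supermodular`), so each
bonus has a unique maximal optimal set. For S in B and S' in C, prizes and costs below `a` add up
and only the path to `a` is shared. Hence `profit_union`: next to S', the set S sees the raised
bonus δ - (δ - x)(1 - π_S'). Both parts of the maximal optimal set of B ∪ C are therefore maximal
optimal in their own groups for raised bonuses (`IsMaximalOptimal.left`), so they occur in the given
descriptions, and only pairs (i, j) of records matter.

The pairs that occur lie on one monotone lattice path. Let e and s be the right end and the slope of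
record i of B, and e' and s' those of record j of C. As x grows from the pair (i, j), B wants to
advance when (δ - x)(1 - s') falls to δ - e, and C when (δ - x)(1 - s) falls to δ - e'. When 1 - s
and 1 - s' are positive, B comes first if (δ - e)(1 - s) exceeds (δ - e')(1 - s'). Each side is a
key of a single record, and keys do not increase along a chain. Merging the two chains by decreasing
key thus visits every optimal pair (`key_lt_key`, `mergePath_eq`, `exists_pairNodes`).

Along the path the node sets grow, and neither the slopes nor the values at δ decrease. The new
description is the upper envelope of these lines, found with a stack (`Envelope`); ties go to the
last line, which has the largest set. Nestedness lets one list of nodes hold all sets as prefixes.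

Every pass of the loop copies a node, pops a line or pushes one. Since the chains are strict,
records are bounded by nodes, and the total is linear (`inv_run_body`, `size_le`). -/

/-! ### Probabilities and profits -/

namespace TourProblem

/-! ### Separation of sub-trees, and set functions for a fixed outcome. -/

section

variable {T : RootedTree.{u}}

theorem eq_of_covBy_of_le {a i i' v : T} (hi : a ⋖ i) (hi' : a ⋖ i') (h : i ≤ v) (h' : i' ≤ v) :
    i = i' := by
  rcases (le_total_of_directed h' h : i ≤ i' ∨ i' ≤ i) with hl | hl
  · exact hl.eq_of_not_lt fun hlt => hi'.2 hi.1 hlt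
  · exact (hl.eq_of_not_lt fun hlt => hi.2 hi'.1 hlt).symm

/-- The first alternative of `h` yields disjointness of node sets. The second, where `e` stands for
the edge to its parent, yields disjointness of the edges travelled below `a`. -/
theorem eq_of_mem_subTreeNodes {a i i' v w : T} (hi : v ∈ subTreeNodes a i)
    (hi' : w ∈ subTreeNodes a i') (h : v = w ∨ ∃ e, a < e ∧ e ≤ v ∧ e ≤ w) : i = i' := by
  rcases hi with ⟨rfl, rfl⟩ | ⟨hi, hv⟩ <;> rcases hi' with ⟨rfl, rfl⟩ | ⟨hi', hw⟩
  · rfl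
  · rcases h with rfl | ⟨e, he, hev, -⟩
    · exact absurd hi'.1 (not_lt_of_ge hw)
    · exact absurd he (not_lt_of_ge hev)
  · rcases h with rfl | ⟨e, he, -, hew⟩
    · exact absurd hi.1 (not_lt_of_ge hv)
    · exact absurd he (not_lt_of_ge hew)
  · rcases h with rfl | ⟨e, he, hev, hew⟩
    · exact eq_of_covBy_of_le hi hi' hv hw
    · have key : ∀ {j u : T}, a ⋖ j → j ≤ u → e ≤ u → j ≤ e := by
        intro j u hj hu heu
        rcases (le_total_of_directed heu hu : j ≤ e ∨ e ≤ j) with hl | hl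
        · exact hl
        · exact (hl.eq_of_not_lt fun hlt => hj.2 he hlt).ge
      exact eq_of_covBy_of_le hi hi' (key hi hv hev) (key hi' hw hew)

theorem hit_empty (ω : Finset T) : hit ∅ ω = 0 := by simp [hit]

theorem hit_nonneg (S ω : Finset T) : 0 ≤ hit S ω := by
  unfold hit; split_ifs <;> norm_num

theorem hit_eq_one_iff {S ω : Finset T} : hit S ω = 1 ↔ ∃ v ∈ S, v ∈ ω := by
  classical
  unfold hit
  split_ifs with h
  · simpa [Finset.Nonempty] using h
  · simpa [Finset.Nonempty] using h

theorem hit_eq_zero_iff {S ω : Finset T} : hit S ω = 0 ↔ ∀ v ∈ S, v ∉ ω := by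
  classical
  unfold hit
  split_ifs with h
  · simpa [Finset.Nonempty] using h
  · simpa [Finset.Nonempty] using h

theorem hit_eq_zero_or_one (S ω : Finset T) : hit S ω = 0 ∨ hit S ω = 1 := by
  unfold hit; split_ifs <;> simp

open Classical in
-- An outcome that hits the intersection hits both sets, and one that hits the union hits at least
-- one of them.
theorem hit_submodular (S S' ω : Finset T) :
    hit (S ∪ S') ω + hit (S ∩ S') ω ≤ hit S ω + hit S' ω := by
  rcases hit_eq_zero_or_one S ω with h | h <;> rcases hit_eq_zero_or_one S' ω with h' | h' <;>
  rcases hit_eq_zero_or_one (S ∪ S') ω with hu | hu <;>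
  rcases hit_eq_zero_or_one (S ∩ S') ω with hi | hi <;>
  rw [h, h', hu, hi] <;> norm_num <;>
  simp only [hit_eq_one_iff, hit_eq_zero_iff, Finset.mem_union, Finset.mem_inter] at h h' hu hi <;>
  grind

open Classical in
theorem revenue_modular (P : TourProblem T) (S S' ω : Finset T) :
    P.revenue (S ∪ S') ω + P.revenue (S ∩ S') ω = P.revenue S ω + P.revenue S' ω :=
  Finset.sum_union_inter

end

/-! ### Expectations, request probabilities and expected profits. -/

variable {T : RootedTree.{u}} [Fintype T] (P : TourProblem T)

theorem outcomeProb_nonneg (ω : Finset T) : 0 ≤ P.outcomeProb ω :=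
  mul_nonneg (Finset.prod_nonneg fun v _ => (P.prob_pos v).le)
    (Finset.prod_nonneg fun v _ => sub_nonneg.2 (P.prob_le_one v))

theorem expect_mono {X Y : Finset T → ℝ} (h : ∀ ω, X ω ≤ Y ω) : P.expect X ≤ P.expect Y :=
  Finset.sum_le_sum fun ω _ => mul_le_mul_of_nonneg_right (h ω) (P.outcomeProb_nonneg ω)

theorem expect_add (X Y : Finset T → ℝ) :
    P.expect (fun ω => X ω + Y ω) = P.expect X + P.expect Y := by
  simp [expect, add_mul, Finset.sum_add_distrib]

theorem expect_sub (X Y : Finset T → ℝ) :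
    P.expect (fun ω => X ω - Y ω) = P.expect X - P.expect Y := by
  simp [expect, sub_mul, Finset.sum_sub_distrib]

theorem expect_const_mul (c : ℝ) (X : Finset T → ℝ) :
    P.expect (fun ω => c * X ω) = c * P.expect X := by
  simp [expect, mul_assoc, Finset.mul_sum]

theorem expect_miss (S : Finset T) :
    P.expect (fun ω => 1 - hit S ω) = ∏ v ∈ S, (1 - P.prob v) := by
  classical
  -- Expanding this product gives a sum over outcomes. Replacing the request factor of the nodes of
  -- `S` by 0 removes the outcomes that hit `S` and leaves the others unchanged.
  have h := Finset.prod_add (fun v => if v ∈ S then 0 else P.prob v) (fun v => 1 - P.prob v)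
    (Finset.univ : Finset T)
  have h1 : ∏ v, ((if v ∈ S then 0 else P.prob v) + (1 - P.prob v)) =
      ∏ v ∈ S, (1 - P.prob v) := by
    rw [← Finset.prod_subset (Finset.subset_univ S)]
    · exact Finset.prod_congr rfl fun v hv => by simp [hv]
    · intro v _ hv
      simp [hv]
  rw [← h1, h, Finset.powerset_univ]
  refine Finset.sum_congr rfl fun ω _ => ?_
  unfold outcomeProb
  rw [← mul_assoc]
  congr 1
  · dsimp only
    by_cases hS : (S ∩ ω).Nonempty
    · obtain ⟨v, hv⟩ := hS
      rw [Finset.mem_inter] at hv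
      rw [Finset.prod_eq_zero (f := fun i => if i ∈ S then 0 else P.prob i) hv.2 (if_pos hv.1),
        hit_eq_one_iff.2 ⟨v, hv⟩, sub_self, zero_mul]
    · rw [hit_eq_zero_iff.2 fun v hv hvω => hS ⟨v, Finset.mem_inter.2 ⟨hv, hvω⟩⟩, sub_zero, one_mul]
      refine Finset.prod_congr rfl fun v hv => ?_
      rw [if_neg fun hvS => hS ⟨v, Finset.mem_inter.2 ⟨hvS, hv⟩⟩]

theorem expect_one : P.expect (fun _ => 1) = 1 := by
  simpa [hit_empty] using P.expect_miss ∅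

theorem requestProb_eq (S : Finset T) : P.requestProb S = 1 - ∏ v ∈ S, (1 - P.prob v) := by
  have h := P.expect_sub (fun _ => 1) (hit S)
  rw [P.expect_miss, expect_one] at h
  unfold requestProb
  linarith

theorem requestProb_nonneg (S : Finset T) : 0 ≤ P.requestProb S :=
  Finset.sum_nonneg fun ω _ => mul_nonneg (hit_nonneg S ω) (P.outcomeProb_nonneg ω)

theorem requestProb_le_one (S : Finset T) : P.requestProb S ≤ 1 := by
  rw [requestProb_eq, sub_le_self_iff]
  exact Finset.prod_nonneg fun v _ => sub_nonneg.2 (P.prob_le_one v)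

open Classical in
theorem requestProb_union {S S' : Finset T} (h : Disjoint S S') :
    P.requestProb (S ∪ S') =
      P.requestProb S + P.requestProb S' - P.requestProb S * P.requestProb S' := by
  simp only [requestProb_eq, Finset.prod_union h]
  ring

open Classical in
-- An edge is travelled exactly when a requesting node of `S` lies below it. As a nonnegative
-- combination of hit indicators, the cost inherits their submodularity.
theorem costFrom_eq (a : T) (S ω : Finset T) :
    P.costFrom a S ω =
      ∑ w ∈ Finset.univ.filter (a < ·), P.arc w * hit (S.filter (w ≤ ·)) ω := by
  unfold costFrom
  rw [← Finset.filter_filter, Finset.sum_filter]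
  refine Finset.sum_congr rfl fun w _ => ?_
  split_ifs with h
  · rw [hit_eq_one_iff.2, mul_one]
    obtain ⟨s, hs, hw⟩ := h
    rw [Finset.mem_inter] at hs
    exact ⟨s, by simp [hs.1, hw], hs.2⟩
  · rw [hit_eq_zero_iff.2, mul_zero]
    intro s hs hsω
    rw [Finset.mem_filter] at hs
    exact h ⟨s, by simp [hs.1, hsω], hs.2⟩

/-- Without a request no edge below `a` is travelled, so the factor `hit` in the cost matters only
for the path to `a`. -/
theorem costFrom_mul_hit (a : T) (S ω : Finset T) :
    P.costFrom a S ω * hit S ω = P.costFrom a S ω := by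
  classical
  rcases hit_eq_zero_or_one S ω with h | h
  · rw [costFrom_eq, h, mul_zero, Finset.sum_eq_zero]
    intro w _
    rw [hit_eq_zero_iff] at h
    rw [hit_eq_zero_iff.2 fun v hv => h v (Finset.mem_of_mem_filter v hv), mul_zero]
  · rw [h, mul_one]

theorem cost_eq (a : T) (S : Finset T) (x : ℝ) (ω : Finset T) :
    P.cost a S x ω = (P.dist a - x) * hit S ω + P.costFrom a S ω := by
  rw [cost, add_mul, costFrom_mul_hit]

theorem dist_nonneg (a : T) : 0 ≤ P.dist a := Finset.sum_nonneg fun w _ => P.arc_nonneg w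

/-- The profit of a set is affine in the bonus. -/
theorem profit_eq (a : T) (S : Finset T) (x : ℝ) :
    P.profit a S x = P.profit a S (P.dist a) - (P.dist a - x) * P.requestProb S := by
  unfold profit requestProb
  rw [← expect_const_mul, ← expect_sub]
  congr 1
  funext ω
  simp only [cost_eq]
  ring

open Classical in
theorem costFrom_submodular (a : T) (S S' ω : Finset T) :
    P.costFrom a (S ∪ S') ω + P.costFrom a (S ∩ S') ω ≤
      P.costFrom a S ω + P.costFrom a S' ω := by
  simp only [costFrom_eq, ← Finset.sum_add_distrib, ← mul_add, Finset.filter_union,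
    Finset.filter_inter_distrib]
  exact Finset.sum_le_sum fun w _ =>
    mul_le_mul_of_nonneg_left (hit_submodular _ _ _) (P.arc_nonneg w)

open Classical in
-- Revenue is modular and both cost terms are submodular; `hx` makes the coefficient of the path to
-- `a` nonnegative.
theorem profit_supermodular {a : T} {x : ℝ} (hx : x ≤ P.dist a) (S S' : Finset T) :
    P.profit a S x + P.profit a S' x ≤ P.profit a (S ∪ S') x + P.profit a (S ∩ S') x := by
  unfold profit
  rw [← expect_add, ← expect_add]
  refine P.expect_mono fun ω => ?_
  simp only [cost_eq]
  have h1 := P.revenue_modular S S' ω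
  have h2 := P.costFrom_submodular a S S' ω
  have h3 := mul_le_mul_of_nonneg_left (hit_submodular S S' ω) (sub_nonneg.2 hx)
  linarith

/-! ### Optimal sets and the uniqueness of the maximal one. -/

theorem profit_le_charFun {a : T} {I : Finset T} {S : Finset T} (hS : S ⊆ groupNodes a I) (x : ℝ) :
    P.profit a S x ≤ P.charFun a I x :=
  Finset.le_sup' (fun S => P.profit a S x) (Finset.mem_powerset.2 hS)

theorem isOptimal_iff {a : T} {I : Finset T} {x : ℝ} {S : Finset T} :
    P.IsOptimal a I x S ↔ S ⊆ groupNodes a I ∧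
      ∀ S' ⊆ groupNodes a I, P.profit a S' x ≤ P.profit a S x := by
  constructor
  · rintro ⟨h, h'⟩
    exact ⟨h, fun S' hS' => h' ▸ P.profit_le_charFun hS' x⟩
  · rintro ⟨h, h'⟩
    exact ⟨h, le_antisymm (P.profit_le_charFun h x)
      (Finset.sup'_le _ _ fun S' hS' => h' S' (Finset.mem_powerset.1 hS'))⟩

theorem exists_isMaximalOptimal (a : T) (I : Finset T) (x : ℝ) :
    ∃ S, P.IsMaximalOptimal a I x S := by
  obtain ⟨S, hS, h⟩ := Finset.exists_mem_eq_sup' (Finset.powerset_nonempty (groupNodes a I))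
    fun S => P.profit a S x
  obtain ⟨S', -, h'⟩ := (Set.toFinite {S | P.IsOptimal a I x S}).exists_le_maximal
    (a := S) ⟨Finset.mem_powerset.1 hS, h.symm⟩
  exact ⟨S', h'⟩

open Classical in
-- By supermodularity, the profits of union and intersection add up to at least twice the optimum,
-- while neither exceeds it.
theorem IsOptimal.union {a : T} {I : Finset T} {x : ℝ} (hx : x ≤ P.dist a) {S S' : Finset T}
    (h : P.IsOptimal a I x S) (h' : P.IsOptimal a I x S') : P.IsOptimal a I x (S ∪ S') := by
  have hu := Finset.union_subset h.1 h'.1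
  refine ⟨hu, le_antisymm (P.profit_le_charFun hu x) ?_⟩
  have h1 := P.profit_supermodular hx S S'
  have h2 := P.profit_le_charFun (Finset.inter_subset_left.trans h.1 : S ∩ S' ⊆ _) x
  have h3 := h.2
  have h4 := h'.2
  linarith

theorem IsMaximalOptimal.unique {a : T} {I : Finset T} {x : ℝ} (hx : x ≤ P.dist a)
    {S S' : Finset T} (h : P.IsMaximalOptimal a I x S) (h' : P.IsMaximalOptimal a I x S') :
    S = S' := by
  classical
  have hu := IsOptimal.union P hx h.1 h'.1
  have e1 := h.eq_of_le hu Finset.subset_union_left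
  have e2 := h'.eq_of_le hu Finset.subset_union_right
  exact e1.trans e2.symm

/-! ### Groups of sub-trees -/

theorem mem_groupNodes {a : T} {I : Finset T} {v : T} :
    v ∈ groupNodes a I ↔ ∃ i ∈ I, v ∈ subTreeNodes a i := by
  simp [groupNodes]

theorem groupNodes_disjoint (a : T) {B C : Finset T} (h : Disjoint B C) :
    Disjoint (groupNodes a B) (groupNodes a C) := by
  rw [Finset.disjoint_left]
  intro v hB hC
  obtain ⟨i, hi, hv⟩ := mem_groupNodes.1 hB
  obtain ⟨j, hj, hv'⟩ := mem_groupNodes.1 hC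
  exact Finset.disjoint_left.1 h hi (eq_of_mem_subTreeNodes hv hv' (.inl rfl) ▸ hj)

open Classical in
theorem costFrom_union {a : T} {B C : Finset T} (h : Disjoint B C) {S S' : Finset T}
    (hS : S ⊆ groupNodes a B) (hS' : S' ⊆ groupNodes a C) (ω : Finset T) :
    P.costFrom a (S ∪ S') ω = P.costFrom a S ω + P.costFrom a S' ω := by
  unfold costFrom
  rw [← Finset.sum_union]
  · congr 1
    ext w
    simp only [Finset.mem_filter, Finset.mem_univ, true_and, Finset.mem_inter, Finset.mem_union]
    grind
  · rw [Finset.disjoint_left]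
    intro w hw hw'
    simp only [Finset.mem_filter, Finset.mem_univ, true_and, Finset.mem_inter] at hw hw'
    obtain ⟨ha, s, ⟨hs, -⟩, hws⟩ := hw
    obtain ⟨-, s', ⟨hs', -⟩, hws'⟩ := hw'
    obtain ⟨i, hi, hv⟩ := mem_groupNodes.1 (hS hs)
    obtain ⟨j, hj, hv'⟩ := mem_groupNodes.1 (hS' hs')
    exact Finset.disjoint_left.1 h hi
      (eq_of_mem_subTreeNodes hv hv' (.inr ⟨w, ha, hws, hws'⟩) ▸ hj)

open Classical in
-- At the full bonus the shared path to `a` is free, and nothing else couples the groups.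
theorem profit_union_dist {a : T} {B C : Finset T} (h : Disjoint B C) {S S' : Finset T}
    (hS : S ⊆ groupNodes a B) (hS' : S' ⊆ groupNodes a C) :
    P.profit a (S ∪ S') (P.dist a) = P.profit a S (P.dist a) + P.profit a S' (P.dist a) := by
  have hd : Disjoint S S' := Finset.disjoint_of_subset_left hS
    (Finset.disjoint_of_subset_right hS' (groupNodes_disjoint a h))
  unfold profit
  rw [← expect_add]
  congr 1
  funext ω
  simp only [cost_eq, sub_self, zero_mul, zero_add, P.costFrom_union h hS hS', revenue,
    Finset.sum_union hd]
  ring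

open Classical in
/-- Seen from the first group, the presence of a set of the second group only raises the bonus. -/
theorem profit_union {a : T} {B C : Finset T} (h : Disjoint B C) {S S' : Finset T}
    (hS : S ⊆ groupNodes a B) (hS' : S' ⊆ groupNodes a C) (x : ℝ) :
    P.profit a (S ∪ S') x = P.profit a S' x +
      P.profit a S (P.dist a - (P.dist a - x) * (1 - P.requestProb S')) := by
  have hd : Disjoint S S' := Finset.disjoint_of_subset_left hS
    (Finset.disjoint_of_subset_right hS' (groupNodes_disjoint a h))
  rw [P.profit_eq a (S ∪ S'), P.profit_union_dist h hS hS', P.requestProb_union hd,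
    P.profit_eq a S' x, P.profit_eq a S (_ - _)]
  ring

open Classical in
/-- The part of a maximal optimal set of two groups in the first group is maximal optimal for the
bonus raised by the part in the second group. -/
theorem IsMaximalOptimal.left {a : T} {B C I : Finset T} (h : Disjoint B C)
    (hI : groupNodes a I = groupNodes a B ∪ groupNodes a C) {S S' : Finset T}
    (hS : S ⊆ groupNodes a B) (hS' : S' ⊆ groupNodes a C) {x : ℝ}
    (hM : P.IsMaximalOptimal a I x (S ∪ S')) :
    P.IsMaximalOptimal a B (P.dist a - (P.dist a - x) * (1 - P.requestProb S')) S := by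
  obtain ⟨hO, hmax⟩ := hM
  rw [isOptimal_iff, hI] at hO
  have hopt : ∀ R ⊆ groupNodes a B,
      P.profit a R (P.dist a - (P.dist a - x) * (1 - P.requestProb S')) ≤
        P.profit a S (P.dist a - (P.dist a - x) * (1 - P.requestProb S')) := by
    intro R hR
    have := hO.2 (R ∪ S') (Finset.union_subset_union hR hS')
    rw [P.profit_union h hR hS', P.profit_union h hS hS'] at this
    linarith
  refine ⟨P.isOptimal_iff.2 ⟨hS, hopt⟩, fun R hR hle v hv => ?_⟩
  rw [isOptimal_iff] at hR
  -- An optimal `R` above `S` makes `R ∪ S'` optimal for `I`, hence contained in `S ∪ S'`; the nodes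
  -- of `R` cannot lie in `S'`, which belongs to the other group.
  have hRO : P.IsOptimal a I x (R ∪ S') := by
    rw [isOptimal_iff, hI]
    refine ⟨Finset.union_subset_union hR.1 hS', fun Q hQ => (hO.2 Q hQ).trans ?_⟩
    rw [P.profit_union h hR.1 hS', P.profit_union h hS hS']
    linarith [hR.2 S hS]
  have hsub := hmax hRO (Finset.union_subset_union hle subset_rfl)
  rcases Finset.mem_union.1 (hsub (Finset.mem_union_left _ hv)) with h1 | h1
  · exact h1
  · exact absurd (hS' h1) (Finset.disjoint_left.1 (groupNodes_disjoint a h) (hR.1 hv))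

end TourProblem

/-! ### Merging two chains by keys -/

open Classical in
/-- One step of the merge of two chains of lengths `nB` and `nC`: the chain with the larger key
advances. -/
noncomputable def mergeStep (nB nC : ℕ) (κB κC : ℕ → ℝ) (p : ℕ × ℕ) : ℕ × ℕ :=
  if p.1 < nB ∧ (p.2 < nC → κC p.2 ≤ κB p.1) then (p.1 + 1, p.2) else (p.1, p.2 + 1)

/-- The monotone lattice path followed by the merge. -/
noncomputable def mergePath (nB nC : ℕ) (κB κC : ℕ → ℝ) : ℕ → ℕ × ℕ
  | 0 => (0, 0)
  | K + 1 => mergeStep nB nC κB κC (mergePath nB nC κB κC K)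

section mergePath

variable {nB nC : ℕ} {κB κC : ℕ → ℝ}

theorem mergePath_sum (K : ℕ) :
    (mergePath nB nC κB κC K).1 + (mergePath nB nC κB κC K).2 = K := by
  induction K with
  | zero => rfl
  | succ K ih => unfold mergePath mergeStep; split_ifs <;> simp <;> omega

theorem mergePath_mono : Monotone (mergePath nB nC κB κC) := by
  refine monotone_nat_of_le_succ fun K => ?_
  conv_rhs => unfold mergePath mergeStep
  split_ifs <;> simp [Prod.le_def]

theorem mergePath_le {K : ℕ} (hK : K ≤ nB + nC) :
    (mergePath nB nC κB κC K).1 ≤ nB ∧ (mergePath nB nC κB κC K).2 ≤ nC := by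
  induction K with
  | zero => simp [mergePath]
  | succ K ih =>
    have h1 := ih (by omega)
    have h2 := mergePath_sum (nB := nB) (nC := nC) (κB := κB) (κC := κC) K
    unfold mergePath mergeStep
    split_ifs with h
    · exact ⟨h.1, h1.2⟩
    · refine ⟨h1.1, ?_⟩
      show _ + 1 ≤ nC
      by_contra hlt
      exact h ⟨by omega, fun h' => absurd h' (by omega)⟩

/-- The merge passes through every pair `(i, j)` such that in each chain the last key before the
pair exceeds the next key of the other chain. -/
theorem mergePath_eq {i j : ℕ} (hi : i ≤ nB) (hj : j ≤ nC)
    (hB : ∀ l l', l ≤ l' → l' < nB → κB l' ≤ κB l)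
    (hC : ∀ l l', l ≤ l' → l' < nC → κC l' ≤ κC l)
    (hij : ∀ l, l + 1 = i → j < nC → κC j < κB l)
    (hji : ∀ l, l + 1 = j → i < nB → κB i < κC l) :
    mergePath nB nC κB κC (i + j) = (i, j) := by
  -- Every step raises the coordinate sum by one, so it suffices that the path stays in the box
  -- below `(i, j)` up to step `i + j`.
  have key : ∀ K ≤ i + j, (mergePath nB nC κB κC K).1 ≤ i ∧ (mergePath nB nC κB κC K).2 ≤ j := by
    intro K hK
    induction K with
    | zero => simp [mergePath]
    | succ K ih =>
      have h1 := ih (by omega)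
      have h2 := mergePath_sum (nB := nB) (nC := nC) (κB := κB) (κC := κC) K
      unfold mergePath mergeStep
      generalize mergePath nB nC κB κC K = p at h1 h2
      obtain ⟨k, l⟩ := p
      dsimp only at h1 h2 ⊢
      split_ifs with h
      · refine ⟨?_, h1.2⟩
        show k + 1 ≤ i
        by_contra hlt
        obtain rfl : k = i := by omega
        -- Leaving the box at `(i, l)` with `l < j` would give κC l ≤ κB i < κC (j - 1) ≤ κC l.
        have e := h.2 (by omega)
        have e1 := hji (j - 1) (by omega) h.1
        have e2 := hC l (j - 1) (by omega) (by omega)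
        linarith
      · refine ⟨h1.1, ?_⟩
        show l + 1 ≤ j
        by_contra hlt
        obtain rfl : l = j := by omega
        refine h ⟨by omega, fun h' => ?_⟩
        have e1 := hij (i - 1) (by omega) h'
        have e2 := hB k (i - 1) (by omega) (by omega)
        linarith
  have h1 := key _ le_rfl
  have h2 := mergePath_sum (nB := nB) (nC := nC) (κB := κB) (κC := κC) (i + j)
  ext <;> dsimp only <;> omega

end mergePath

/-! ### The upper envelope of a sequence of lines -/

/-- The line with slope `s` and value `v` at `δ`. -/
def lineAt (δ s v y : ℝ) : ℝ := v - (δ - y) * s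

/-- A state of the incremental computation of the upper envelope on `[0, δ]` of the lines with
slopes `s 0, s 1, …` and values `v 0, v 1, …` at `δ`. The lines with index less than `K` have been
processed; the `m` lines `k 0, k 1, …` are on the stack, and from `x l` on, the line `k l` is the
last of the maximal lines. The line `K` is known to dominate the others from `ξ` on. -/
structure Envelope (δ : ℝ) (s v : ℕ → ℝ) (K m : ℕ) (k : ℕ → ℕ) (x : ℕ → ℝ) (ξ : ℝ) : Prop where
  idx_lt : ∀ l < m, k l < K
  start : 0 < m → x 0 = 0
  le_end : ∀ l < m, x l ≤ δ
  lt_succ : ∀ l, l + 1 < m → x l < x (l + 1) ∧ k l < k (l + 1) ∧ s (k l) < s (k (l + 1))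
  region : ∀ l < m, ∀ y, x l ≤ y → y ≤ δ → (l + 1 < m → y < x (l + 1)) → (l + 1 = m → y < ξ) →
    ∀ k' < K, lineAt δ (s k') (v k') y ≤ lineAt δ (s (k l)) (v (k l)) y ∧
      (k l < k' → lineAt δ (s k') (v k') y < lineAt δ (s (k l)) (v (k l)) y)
  dominates : ∀ y, 0 ≤ y → y ≤ δ → ξ ≤ y → ∀ k' < K,
    lineAt δ (s k') (v k') y ≤ lineAt δ (s K) (v K) y
  empty : m = 0 → ξ ≤ 0

namespace Envelope

variable {δ : ℝ} {s v : ℕ → ℝ} {K m : ℕ} {k k' : ℕ → ℕ} {x x' : ℕ → ℝ} {ξ : ℝ}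

theorem init : Envelope δ s v 0 0 k x 0 where
  idx_lt := by simp
  start := by simp
  le_end := by simp
  lt_succ := by simp
  region := by simp
  dominates := by simp
  empty := by simp

theorem lineAt_mono {s₁ s₂ v₁ v₂ y z : ℝ} (hs : s₁ ≤ s₂) (hy : y ≤ z)
    (h : lineAt δ s₁ v₁ y ≤ lineAt δ s₂ v₂ y) : lineAt δ s₁ v₁ z ≤ lineAt δ s₂ v₂ z := by
  unfold lineAt at *
  nlinarith [mul_nonneg (sub_nonneg.2 hs) (sub_nonneg.2 hy)]

theorem start_le (h : Envelope δ s v K m k x ξ) : ∀ l < m, 0 ≤ x l := by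
  intro l hl
  induction l with
  | zero => rw [h.start hl]
  | succ l ih => exact (ih (by omega)).trans (h.lt_succ l hl).1.le

theorem le_last (h : Envelope δ s v K (m + 1) k x ξ) : ∀ l ≤ m, x l ≤ x m := by
  induction m with
  | zero => intro l hl; obtain rfl : l = 0 := by omega
            rfl
  | succ m ih =>
    suffices hs : ∀ i, ∀ l, l + i = m + 1 → x l ≤ x (m + 1) from
      fun l hl => hs (m + 1 - l) l (by omega)
    intro i
    induction i with
    | zero => intro l hl; obtain rfl : l = m + 1 := by omega
              rfl
    | succ i ih => intro l hl; exact (h.lt_succ l (by omega)).1.le.trans (ih (l + 1) (by omega))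

/-- The line `K` is at least as steep as the top and not below it where the top's range begins, so
it replaces the top throughout that range. The point from which `K` dominates moves down to `x m`.
-/
theorem pop (h : Envelope δ s v K (m + 1) k x ξ) (hs : ∀ k' < K, s k' ≤ s K)
    (hle : lineAt δ (s (k m)) (v (k m)) (x m) ≤ lineAt δ (s K) (v K) (x m)) :
    Envelope δ s v K m k x (x m) where
  idx_lt l hl := h.idx_lt l (by omega)
  start hm := h.start (by omega)
  le_end l hl := h.le_end l (by omega)
  lt_succ l hl := h.lt_succ l (by omega)
  region l hl y hy hyδ h1 h2 := h.region l (by omega) y hy hyδ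
    (fun _ => (Nat.lt_or_ge (l + 1) m).elim h1 fun hge => by
      obtain rfl : l + 1 = m := by omega
      exact h2 rfl) (by omega)
  dominates y hy0 hyδ hy k' hk' := by
    rcases lt_or_ge y ξ with hlt | hge
    · exact (h.region m (by omega) y hy hyδ (by omega) (fun _ => hlt) k' hk').1.trans
        (lineAt_mono (hs _ (h.idx_lt m (by omega))) hy hle)
    · exact h.dominates y hy0 hyδ hge k' hk'
  empty hm := by subst hm; exact (h.start (by omega)).le

/-- The new bound `δ + 1` expresses that nothing is known yet about the next line: on `[0, δ]` it
makes `dominates` void and the condition `y < ξ` automatic. -/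
theorem push_empty (h : Envelope δ s v K 0 k x ξ) (hδ : 0 ≤ δ) (hk : k' 0 = K) (hx : x' 0 = 0) :
    Envelope δ s v (K + 1) 1 k' x' (δ + 1) where
  idx_lt l hl := by obtain rfl : l = 0 := by omega
                    omega
  start _ := hx
  le_end l hl := by obtain rfl : l = 0 := by omega
                    rwa [hx]
  lt_succ l hl := by omega
  region l hl y hy hyδ _ _ i hi := by
    obtain rfl : l = 0 := by omega
    rw [hk, hx] at *
    refine ⟨?_, by omega⟩
    rcases Nat.lt_succ_iff_lt_or_eq.1 hi with hi | rfl
    · exact h.dominates y hy hyδ ((h.empty rfl).trans hy) i hi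
    · rfl
  dominates y _ hyδ hy := by linarith
  empty := by simp

/-- The new line starts where it crosses the top. By `hlt` the crossing lies beyond `x m`, and by
`hv` it does not lie beyond `δ`. -/
theorem push (h : Envelope δ s v K (m + 1) k x ξ) (hs : s (k m) ≤ s K) (hv : v (k m) ≤ v K)
    (hlt : lineAt δ (s K) (v K) (x m) < lineAt δ (s (k m)) (v (k m)) (x m))
    (hk : ∀ l ≤ m, k' l = k l) (hx : ∀ l ≤ m, x' l = x l) (hkm : k' (m + 1) = K)
    (hxm : x' (m + 1) = δ - (v K - v (k m)) / (s K - s (k m))) :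
    Envelope δ s v (K + 1) (m + 2) k' x' (δ + 1) := by
  have hd := h.le_end m (by omega)
  -- A parallel line with no smaller value at `δ` could not be below the top.
  have hslt : s (k m) < s K := by
    unfold lineAt at hlt
    by_contra hge
    have : s K = s (k m) := by linarith
    rw [this] at hlt
    linarith
  have hspos : 0 < s K - s (k m) := sub_pos.2 hslt
  have hdiv : (v K - v (k m)) / (s K - s (k m)) * (s K - s (k m)) = v K - v (k m) :=
    div_mul_cancel₀ _ hspos.ne'
  have hdiv0 : 0 ≤ (v K - v (k m)) / (s K - s (k m)) :=
    div_nonneg (sub_nonneg.2 hv) hspos.le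
  set z := x' (m + 1) with hz
  have hcross : ∀ y, z ≤ y → lineAt δ (s (k m)) (v (k m)) y ≤ lineAt δ (s K) (v K) y := by
    intro y hy
    unfold lineAt
    rw [hxm] at hy
    nlinarith [mul_le_mul_of_nonneg_right hy hspos.le]
  have hcross' : ∀ y, y < z → lineAt δ (s K) (v K) y < lineAt δ (s (k m)) (v (k m)) y := by
    intro y hy
    unfold lineAt
    rw [hxm] at hy
    nlinarith [mul_lt_mul_of_pos_right hy hspos]
  have hxz : x m < z := by
    by_contra hge
    exact absurd (hcross _ (not_lt.1 hge)) (not_le.2 hlt)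
  have hzδ : z ≤ δ := by rw [hxm]; linarith
  refine ⟨?_, ?_, ?_, ?_, ?_, ?_, by simp⟩
  · intro l hl
    rcases Nat.lt_or_ge l (m + 1) with h1 | h1
    · rw [hk l (by omega)]
      exact (h.idx_lt l h1).trans (Nat.lt_succ_self K)
    · obtain rfl : l = m + 1 := by omega
      omega
  · intro _
    rw [hx 0 (by omega)]
    exact h.start (by omega)
  · intro l hl
    rcases Nat.lt_or_ge l (m + 1) with h1 | h1
    · rw [hx l (by omega)]
      exact h.le_end l h1
    · obtain rfl : l = m + 1 := by omega
      exact hzδ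
  · intro l hl
    rw [hx l (by omega), hk l (by omega)]
    rcases Nat.lt_or_ge (l + 1) (m + 1) with h1 | h1
    · rw [hx (l + 1) (by omega), hk (l + 1) (by omega)]
      exact h.lt_succ l h1
    · obtain rfl : l = m := by omega
      rw [hkm]
      exact ⟨hxz, h.idx_lt l (by omega), hslt⟩
  · intro l hl y hy hyδ h1 h2 i hi
    rcases Nat.lt_or_ge l (m + 1) with hlm | hlm
    · have hyz : y < z := by
        rcases Nat.lt_or_ge l m with h3 | h3
        · have := h1 (by omega)
          rw [hx (l + 1) (by omega)] at this
          exact this.trans_le ((h.le_last (l + 1) (by omega)).trans hxz.le)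
        · obtain rfl : l = m := by omega
          exact h1 (by omega)
      have hy0 : 0 ≤ y := (h.start_le l hlm).trans (by rwa [← hx l (by omega)])
      -- From `ξ` on, `K` dominates the top, but to the left of the crossing `z` it is strictly
      -- below.
      have hyξ : y < ξ := by
        by_contra hge
        exact absurd (h.dominates y hy0 hyδ (not_lt.1 hge) _ (h.idx_lt m (by omega)))
          (not_le.2 (hcross' y hyz))
      have hreg := h.region l hlm y (by rwa [← hx l (by omega)]) hyδ
        (fun h3 => by rw [← hx (l + 1) (by omega)]; exact h1 (by omega)) (fun _ => hyξ)
      rw [hk l (by omega)]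
      rcases Nat.lt_succ_iff_lt_or_eq.1 hi with hi | rfl
      · exact hreg i hi
      · have := (hcross' y hyz).trans_le (hreg _ (h.idx_lt m (by omega))).1
        exact ⟨this.le, fun _ => this⟩
    · obtain rfl : l = m + 1 := by omega
      rw [hkm]
      refine ⟨?_, by omega⟩
      have hy' : x m ≤ y := hxz.le.trans hy
      rcases Nat.lt_succ_iff_lt_or_eq.1 hi with hi | rfl
      · rcases lt_or_ge y ξ with h3 | h3
        · exact (h.region m (by omega) y hy' hyδ (by omega) (fun _ => h3) i hi).1.trans
            (hcross y hy)
        · exact h.dominates y ((h.start_le m (by omega)).trans hy') hyδ h3 i hi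
      · rfl
  · intro y _ hyδ hy
    linarith

end Envelope

/-! ### Running programs -/

namespace RealRAM

/-- Programs without loops. -/
def Prog.LoopFree : Prog → Prop
  | .seq p₁ p₂ => p₁.LoopFree ∧ p₂.LoopFree
  | .branch _ p₁ p₂ => p₁.LoopFree ∧ p₂.LoopFree
  | .loop _ _ => False
  | _ => True

open Classical in
/-- The final memory of a loop-free program. -/
noncomputable def Prog.run : Prog → Store → Store
  | .nop, σ => σ
  | .setNat r e, σ => { σ with nat := Function.update σ.nat r (e.eval σ) }
  | .setReal r e, σ => { σ with real := Function.update σ.real r (e.eval σ) }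
  | .writeNat arr idx e, σ => { σ with
      natArr := Function.update σ.natArr arr
        (Function.update (σ.natArr arr) (idx.eval σ) (e.eval σ)) }
  | .writeReal arr idx e, σ => { σ with
      realArr := Function.update σ.realArr arr
        (Function.update (σ.realArr arr) (idx.eval σ) (e.eval σ)) }
  | .seq p₁ p₂, σ => p₂.run (p₁.run σ)
  | .branch b p₁ p₂, σ => if b.Holds σ then p₁.run σ else p₂.run σ
  | .loop _ _, σ => σ

/-- A bound for the number of steps of a loop-free program. -/
def Prog.maxSteps : Prog → ℕ
  | .nop => 1
  | .setNat _ e => e.steps + 1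
  | .setReal _ e => e.steps + 1
  | .writeNat _ idx e => idx.steps + e.steps + 1
  | .writeReal _ idx e => idx.steps + e.steps + 1
  | .seq p₁ p₂ => p₁.maxSteps + p₂.maxSteps
  | .branch b p₁ p₂ => b.steps + 1 + max p₁.maxSteps p₂.maxSteps
  | .loop _ _ => 0

theorem Prog.LoopFree.exec {p : Prog} (hp : p.LoopFree) (σ : Store) :
    ∃ t ≤ p.maxSteps, Exec p σ t (p.run σ) := by
  induction p generalizing σ with
  | nop => exact ⟨_, le_rfl, .nop σ⟩
  | setNat r e => exact ⟨_, le_rfl, .setNat σ r e⟩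
  | setReal r e => exact ⟨_, le_rfl, .setReal σ r e⟩
  | writeNat arr idx e => exact ⟨_, le_rfl, .writeNat σ arr idx e⟩
  | writeReal arr idx e => exact ⟨_, le_rfl, .writeReal σ arr idx e⟩
  | seq p₁ p₂ ih₁ ih₂ =>
    obtain ⟨t₁, h₁, e₁⟩ := ih₁ hp.1 σ
    obtain ⟨t₂, h₂, e₂⟩ := ih₂ hp.2 (p₁.run σ)
    exact ⟨_, Nat.add_le_add h₁ h₂, .seq e₁ e₂⟩
  | branch b p₁ p₂ ih₁ ih₂ =>
    by_cases hb : b.Holds σ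
    · obtain ⟨t, h, e⟩ := ih₁ hp.1 σ
      refine ⟨_, Nat.add_le_add_left (h.trans (le_max_left _ _)) _, ?_⟩
      rw [Prog.run, if_pos hb]
      exact .branchTrue hb e
    · obtain ⟨t, h, e⟩ := ih₂ hp.2 σ
      refine ⟨_, Nat.add_le_add_left (h.trans (le_max_right _ _)) _, ?_⟩
      rw [Prog.run, if_neg hb]
      exact .branchFalse hb e
  | loop b p => exact hp.elim

/-- A loop whose loop-free body decreases a variant halts after a number of steps that is linear in
the variant. -/
theorem exec_loop {b : Test} {p : Prog} (hp : p.LoopFree) (Inv : Store → ℕ → Prop)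
    (step : ∀ σ μ, Inv σ μ → b.Holds σ → ∃ μ' < μ, Inv (p.run σ) μ') (μ : ℕ) (σ : Store)
    (h : Inv σ μ) :
    ∃ t σ', Exec (.loop b p) σ t σ' ∧ t ≤ (b.steps + 1 + p.maxSteps) * (μ + 1) ∧
      (∃ μ', Inv σ' μ') ∧ ¬ b.Holds σ' := by
  induction μ using Nat.strong_induction_on generalizing σ with
  | _ μ ih =>
    by_cases hb : b.Holds σ
    · obtain ⟨μ', hlt, hInv⟩ := step σ μ h hb
      obtain ⟨t₂, σ', e₂, ht₂, h'⟩ := ih μ' hlt _ hInv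
      obtain ⟨t₁, ht₁, e₁⟩ := hp.exec σ
      refine ⟨_, σ', .loopTrue hb e₁ e₂, ?_, h'⟩
      calc b.steps + 1 + t₁ + t₂
          ≤ (b.steps + 1 + p.maxSteps) + (b.steps + 1 + p.maxSteps) * (μ' + 1) := by omega
        _ = (b.steps + 1 + p.maxSteps) * (μ' + 2) := by ring
        _ ≤ _ := Nat.mul_le_mul_left _ (by omega)
    · refine ⟨_, σ, .loopFalse hb, ?_, ⟨μ, h⟩, hb⟩
      calc b.steps + 1 ≤ (b.steps + 1 + p.maxSteps) * 1 := by omega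
        _ ≤ _ := Nat.mul_le_mul_left _ (by omega)

/-! ### The merging program

The integer registers `2, …, 7` hold the number of records on the output stack, the indices of the
current records of the two inputs, the numbers of nodes copied from the two inputs, and a flag that
is set at the end; the real register `0` holds the right end of the domain. -/

namespace Merge

/-- Copy the next node of the first input. -/
def copyB : Prog :=
  .seq (.writeNat 5 (.add (.reg 5) (.reg 6)) (.read 1 (.reg 5)))
    (.setNat 5 (.add (.reg 5) (.lit 1)))

/-- Copy the next node of the second input. -/
def copyC : Prog :=
  .seq (.writeNat 5 (.add (.reg 5) (.reg 6)) (.read 3 (.reg 6)))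
    (.setNat 6 (.add (.reg 6) (.lit 1)))

/-- The slope of the current pair of records. -/
def slopeE : RExp :=
  .sub (.add (.read 2 (.reg 3)) (.read 6 (.reg 4))) (.mul (.read 2 (.reg 3)) (.read 6 (.reg 4)))

/-- The value of the current pair of records at the right end of the domain. -/
def valueE : RExp := .add (.read 3 (.reg 3)) (.read 7 (.reg 4))

/-- The index of the top of the output stack. -/
def topE : NExp := .sub (.reg 2) (.lit 1)

/-- The value at `y` of a line. -/
def lineE (s v y : RExp) : RExp := .sub v (.mul (.sub (.reg 0) y) s)

/-- The current line beats the top of the stack already where the latter starts. -/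
def beats : Test :=
  .conj (.natLe (.lit 1) (.reg 2))
    (.realLe (lineE (.read 10 topE) (.read 11 topE) (.read 8 topE))
      (lineE slopeE valueE (.read 8 topE)))

/-- Remove the top of the stack. -/
def pop : Prog := .setNat 2 topE

/-- Compute the left end of the range of the current line. -/
def pushStart : Prog :=
  .branch (.natLe (.lit 1) (.reg 2))
    (.seq (.writeReal 8 (.reg 2)
        (.sub (.reg 0) (.div (.sub valueE (.read 11 topE)) (.sub slopeE (.read 10 topE)))))
      (.writeReal 9 topE (.read 8 (.reg 2))))
    (.writeReal 8 (.reg 2) (.lit 0))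

/-- Put the current line on the stack. -/
def push : Prog :=
  .seq pushStart <| .seq (.writeReal 9 (.reg 2) (.reg 0)) <| .seq (.writeReal 10 (.reg 2) slopeE) <|
    .seq (.writeReal 11 (.reg 2) valueE) <| .seq (.writeNat 4 (.reg 2) (.add (.reg 5) (.reg 6)))
      (.setNat 2 (.add (.reg 2) (.lit 1)))

/-- The merging key of a record. -/
def keyE (arrMax arrSlope reg : ℕ) : RExp :=
  .mul (.sub (.reg 0) (.read arrMax (.reg reg))) (.sub (.lit 1) (.read arrSlope (.reg reg)))

/-- Go to the next pair of records. -/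
def advance : Prog :=
  .branch (.conj (.natLe (.add (.reg 3) (.lit 2)) (.reg 0))
      (.neg (.conj (.natLe (.add (.reg 4) (.lit 2)) (.reg 1))
        (.neg (.realLe (keyE 5 6 4) (keyE 1 2 3))))))
    (.setNat 3 (.add (.reg 3) (.lit 1)))
    (.branch (.natLe (.add (.reg 4) (.lit 2)) (.reg 1))
      (.setNat 4 (.add (.reg 4) (.lit 1)))
      (.setNat 7 (.lit 1)))

/-- The body of the main loop. -/
def body : Prog :=
  .branch (.natLe (.add (.reg 5) (.lit 1)) (.read 0 (.reg 3))) copyB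
    (.branch (.natLe (.add (.reg 6) (.lit 1)) (.read 2 (.reg 4))) copyC
      (.branch beats pop (.seq push advance)))

/-- The initialization. -/
def init : Prog :=
  .seq (.setReal 0 (.read 1 (.sub (.reg 0) (.lit 1)))) <| .seq (.setNat 2 (.lit 0)) <|
    .seq (.setNat 3 (.lit 0)) <| .seq (.setNat 4 (.lit 0)) <| .seq (.setNat 5 (.lit 0)) <|
      .seq (.setNat 6 (.lit 0)) (.setNat 7 (.lit 0))

/-- The test of the main loop. -/
def running : Test := .natLe (.reg 7) (.lit 0)

/-- The merging program. -/
def prog : Prog := .seq init (.loop running body)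

/-! ### Numerical input data and loop invariants. -/

/-- The numerical data on which the merging program works: for either input, the index of the last
record, the numbers and the list of nodes, the right ends, slopes and values of the records. -/
structure Data where
  (nB nC : ℕ)
  (cB lB cC lC : ℕ → ℕ)
  (eB sB vB eC sC vC : ℕ → ℝ)
  δ : ℝ

namespace Data

variable (d : Data)

noncomputable def path : ℕ → ℕ × ℕ :=
  mergePath d.nB d.nC (fun i => (d.δ - d.eB i) * (1 - d.sB i))
    fun j => (d.δ - d.eC j) * (1 - d.sC j)

noncomputable def slope (K : ℕ) : ℝ :=
  d.sB (d.path K).1 + d.sC (d.path K).2 - d.sB (d.path K).1 * d.sC (d.path K).2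

noncomputable def value (K : ℕ) : ℝ := d.vB (d.path K).1 + d.vC (d.path K).2

noncomputable def count (K : ℕ) : ℕ := d.cB (d.path K).1 + d.cC (d.path K).2

/-- The monotonicity of the data. -/
structure Valid : Prop where
  cB_mono : ∀ i i', i ≤ i' → i' ≤ d.nB → d.cB i ≤ d.cB i'
  cC_mono : ∀ i i', i ≤ i' → i' ≤ d.nC → d.cC i ≤ d.cC i'
  sB_mono : ∀ i i', i ≤ i' → i' ≤ d.nB → d.sB i ≤ d.sB i'
  sC_mono : ∀ i i', i ≤ i' → i' ≤ d.nC → d.sC i ≤ d.sC i'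
  vB_mono : ∀ i i', i ≤ i' → i' ≤ d.nB → d.vB i ≤ d.vB i'
  vC_mono : ∀ i i', i ≤ i' → i' ≤ d.nC → d.vC i ≤ d.vC i'
  sB_le : ∀ i ≤ d.nB, d.sB i ≤ 1
  sC_le : ∀ i ≤ d.nC, d.sC i ≤ 1
  δ_nonneg : 0 ≤ d.δ

variable {d}

theorem path_le {K : ℕ} (hK : K ≤ d.nB + d.nC) : (d.path K).1 ≤ d.nB ∧ (d.path K).2 ≤ d.nC :=
  mergePath_le hK

theorem path_sum (K : ℕ) : (d.path K).1 + (d.path K).2 = K := mergePath_sum K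

theorem path_mono : Monotone d.path := mergePath_mono

/-- The slope of a pair is 1 - (1 - s)(1 - s'), which is monotone in both slopes as long as they are
at most 1. -/
theorem Valid.slope_mono (h : d.Valid) {K K' : ℕ} (hK : K ≤ K') (hK' : K' ≤ d.nB + d.nC) :
    d.slope K ≤ d.slope K' := by
  have h1 := d.path_mono hK
  have h2 := path_le hK'
  have h3 := path_le (hK.trans hK')
  have e1 := h.sB_mono _ _ h1.1 h2.1
  have e2 := h.sC_mono _ _ h1.2 h2.2
  have e3 := h.sB_le _ h2.1
  have e4 := h.sC_le _ h3.2
  unfold slope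
  nlinarith [mul_nonneg (sub_nonneg.2 e1) (sub_nonneg.2 e4),
    mul_nonneg (sub_nonneg.2 e2) (sub_nonneg.2 e3)]

theorem Valid.value_mono (h : d.Valid) {K K' : ℕ} (hK : K ≤ K') (hK' : K' ≤ d.nB + d.nC) :
    d.value K ≤ d.value K' := by
  have h1 := d.path_mono hK
  have h2 := path_le hK'
  exact add_le_add (h.vB_mono _ _ h1.1 h2.1) (h.vC_mono _ _ h1.2 h2.2)

variable (d)

/-- The input is in memory. -/
structure Loaded (σ : Store) : Prop where
  nB : σ.nat 0 = d.nB + 1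
  nC : σ.nat 1 = d.nC + 1
  cB : σ.natArr 0 = d.cB
  lB : σ.natArr 1 = d.lB
  cC : σ.natArr 2 = d.cC
  lC : σ.natArr 3 = d.lC
  eB : σ.realArr 1 = d.eB
  sB : σ.realArr 2 = d.sB
  vB : σ.realArr 3 = d.vB
  eC : σ.realArr 5 = d.eC
  sC : σ.realArr 6 = d.sC
  vC : σ.realArr 7 = d.vC
  δ : σ.real 0 = d.δ

/-- The state of the copying of nodes: `pB` and `pC` nodes of the two inputs have been copied, among
them the nodes of the pairs of records before the `K`-th one. -/
structure Copied (out : ℕ → ℕ) (K pB pC : ℕ) : Prop where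
  image : (Finset.range (pB + pC)).image out =
    (Finset.range pB).image d.lB ∪ (Finset.range pC).image d.lC
  le : ∀ K' < K, d.cB (d.path K').1 ≤ pB ∧ d.cC (d.path K').2 ≤ pC
  image_lt : ∀ K' < K, (Finset.range (d.count K')).image out =
    (Finset.range (d.cB (d.path K').1)).image d.lB ∪
      (Finset.range (d.cC (d.path K').2)).image d.lC

/-- The records on the output stack. -/
structure Records (σ : Store) (m : ℕ) (k : ℕ → ℕ) : Prop where
  slope : ∀ l < m, σ.realArr 10 l = d.slope (k l)
  value : ∀ l < m, σ.realArr 11 l = d.value (k l)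
  count : ∀ l < m, σ.natArr 4 l = d.count (k l)
  glue : ∀ l, l + 1 < m → σ.realArr 9 l = σ.realArr 8 (l + 1)

/-- The invariant of the main loop, when the `K`-th pair of records is under consideration. -/
structure Active (σ : Store) (K m : ℕ) (k : ℕ → ℕ) (ξ : ℝ) (pB pC : ℕ) : Prop where
  loaded : d.Loaded σ
  le : K ≤ d.nB + d.nC
  regB : σ.nat 3 = (d.path K).1
  regC : σ.nat 4 = (d.path K).2
  regPB : σ.nat 5 = pB
  regPC : σ.nat 6 = pC
  depth : σ.nat 2 = m
  pB_le : pB ≤ d.cB (d.path K).1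
  pC_le : pC ≤ d.cC (d.path K).2
  copied : d.Copied (σ.natArr 5) K pB pC
  records : d.Records σ m k
  envelope : Envelope d.δ d.slope d.value K m k (σ.realArr 8) ξ

/-- The result, when the main loop ends. -/
structure Finished (σ : Store) (m : ℕ) (k : ℕ → ℕ) : Prop where
  depth : σ.nat 2 = m + 1
  copied : ∃ pB pC, d.Copied (σ.natArr 5) (d.nB + d.nC + 1) pB pC
  records : d.Records σ (m + 1) k
  last : σ.realArr 9 m = d.δ
  envelope : Envelope d.δ d.slope d.value (d.nB + d.nC + 1) (m + 1) k (σ.realArr 8) (d.δ + 1)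

/-- The invariant of the main loop. -/
def Inv (σ : Store) (μ : ℕ) : Prop :=
  (σ.nat 7 = 0 ∧ ∃ K m k ξ pB pC, d.Active σ K m k ξ pB pC ∧
    μ = 2 * (d.nB + d.nC + 1 - K) + m + (d.cB d.nB - pB) + (d.cC d.nC - pC)) ∨
  (σ.nat 7 = 1 ∧ ∃ m k, d.Finished σ m k)

/-! ### Preservation of the invariant by the loop body. -/

variable {d}

theorem image_range_update (f : ℕ → ℕ) (n a m : ℕ) (h : m ≤ n) :
    (Finset.range m).image (Function.update f n a) = (Finset.range m).image f :=
  Finset.image_congr fun i hi => by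
    rw [Finset.coe_range, Set.mem_Iio] at hi
    simp [(hi.trans_le h).ne]

/-- The new node is written at position `pB + pC`, beyond the prefixes of all earlier pairs, which
therefore stay intact. -/
theorem Copied.stepB {out : ℕ → ℕ} {K pB pC : ℕ} (h : d.Copied out K pB pC) :
    d.Copied (Function.update out (pB + pC) (d.lB pB)) K (pB + 1) pC where
  image := by
    rw [show pB + 1 + pC = pB + pC + 1 by ring, Finset.range_add_one, Finset.range_add_one,
      Finset.image_insert, Finset.image_insert, image_range_update _ _ _ _ le_rfl, h.image]
    simp
  le K' hK' := ⟨(h.le K' hK').1.trans (Nat.le_succ _), (h.le K' hK').2⟩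
  image_lt K' hK' := by
    rw [image_range_update _ _ _ (d.count K') (Nat.add_le_add (h.le K' hK').1 (h.le K' hK').2)]
    exact h.image_lt K' hK'

theorem Copied.stepC {out : ℕ → ℕ} {K pB pC : ℕ} (h : d.Copied out K pB pC) :
    d.Copied (Function.update out (pB + pC) (d.lC pC)) K pB (pC + 1) where
  image := by
    rw [show pB + (pC + 1) = pB + pC + 1 by ring, Finset.range_add_one, Finset.range_add_one,
      Finset.image_insert, Finset.image_insert, image_range_update _ _ _ _ le_rfl, h.image]
    simp
  le K' hK' := ⟨(h.le K' hK').1, (h.le K' hK').2.trans (Nat.le_succ _)⟩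
  image_lt K' hK' := by
    rw [image_range_update _ _ _ (d.count K') (Nat.add_le_add (h.le K' hK').1 (h.le K' hK').2)]
    exact h.image_lt K' hK'

theorem Copied.next {out : ℕ → ℕ} {K pB pC : ℕ} (h : d.Copied out K pB pC)
    (hB : pB = d.cB (d.path K).1) (hC : pC = d.cC (d.path K).2) :
    d.Copied out (K + 1) pB pC where
  image := h.image
  le K' hK' := by
    rcases Nat.lt_succ_iff_lt_or_eq.1 hK' with hlt | rfl
    · exact h.le K' hlt
    · exact ⟨hB.ge, hC.ge⟩
  image_lt K' hK' := by
    rcases Nat.lt_succ_iff_lt_or_eq.1 hK' with hlt | rfl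
    · exact h.image_lt K' hlt
    · rw [count, ← hB, ← hC]
      exact h.image

theorem Active.run_copyB {σ : Store} {K m : ℕ} {k : ℕ → ℕ} {ξ : ℝ} {pB pC : ℕ}
    (h : d.Active σ K m k ξ pB pC) (hlt : pB < d.cB (d.path K).1) :
    d.Active (copyB.run σ) K m k ξ (pB + 1) pC := by
  obtain ⟨⟨_, _, _, _, _, _, _, _, _, _, _, _, _⟩, _, _, _, _, _, _, _, _, hc, ⟨_, _, _, _⟩, _⟩ := h
  have hc' := hc.stepB
  constructor
  case loaded => constructor <;> simp_all [copyB, Prog.run, NExp.eval]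
  case records => constructor <;> simp_all [copyB, Prog.run, NExp.eval]
  all_goals simp_all [copyB, Prog.run, NExp.eval]

theorem Active.run_copyC {σ : Store} {K m : ℕ} {k : ℕ → ℕ} {ξ : ℝ} {pB pC : ℕ}
    (h : d.Active σ K m k ξ pB pC) (hlt : pC < d.cC (d.path K).2) :
    d.Active (copyC.run σ) K m k ξ pB (pC + 1) := by
  obtain ⟨⟨_, _, _, _, _, _, _, _, _, _, _, _, _⟩, _, _, _, _, _, _, _, _, hc, ⟨_, _, _, _⟩, _⟩ := h
  have hc' := hc.stepC
  constructor
  case loaded => constructor <;> simp_all [copyC, Prog.run, NExp.eval]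
  case records => constructor <;> simp_all [copyC, Prog.run, NExp.eval]
  all_goals simp_all [copyC, Prog.run, NExp.eval]

theorem Active.slopeE_eval {σ : Store} {K m : ℕ} {k : ℕ → ℕ} {ξ : ℝ} {pB pC : ℕ}
    (h : d.Active σ K m k ξ pB pC) : slopeE.eval σ = d.slope K := by
  simp [slopeE, RExp.eval, NExp.eval, slope, h.regB, h.regC, h.loaded.sB, h.loaded.sC]

theorem Active.valueE_eval {σ : Store} {K m : ℕ} {k : ℕ → ℕ} {ξ : ℝ} {pB pC : ℕ}
    (h : d.Active σ K m k ξ pB pC) : valueE.eval σ = d.value K := by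
  simp [valueE, RExp.eval, NExp.eval, value, h.regB, h.regC, h.loaded.vB, h.loaded.vC]

theorem Active.beats_iff {σ : Store} {K m : ℕ} {k : ℕ → ℕ} {ξ : ℝ} {pB pC : ℕ}
    (h : d.Active σ K m k ξ pB pC) : beats.Holds σ ↔ 0 < m ∧
      lineAt d.δ (d.slope (k (m - 1))) (d.value (k (m - 1))) (σ.realArr 8 (m - 1)) ≤
        lineAt d.δ (d.slope K) (d.value K) (σ.realArr 8 (m - 1)) := by
  have hs := h.slopeE_eval
  have hv := h.valueE_eval
  simp only [beats, Test.Holds, lineE, RExp.eval, NExp.eval, topE, hs, hv, h.depth, h.loaded.δ,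
    lineAt]
  refine and_congr_right fun hm => ?_
  rw [h.records.slope _ (by omega), h.records.value _ (by omega)]

theorem Active.run_pop {σ : Store} {K m : ℕ} {k : ℕ → ℕ} {ξ : ℝ} {pB pC : ℕ} (hd : d.Valid)
    (h : d.Active σ K (m + 1) k ξ pB pC) (hb : beats.Holds σ) :
    d.Active (pop.run σ) K m k (σ.realArr 8 m) pB pC := by
  have hb' := (h.beats_iff.1 hb).2
  have hp := h.envelope.pop (fun k' hk' => hd.slope_mono hk'.le h.le) hb'
  obtain ⟨⟨_, _, _, _, _, _, _, _, _, _, _, _, _⟩, _, _, _, _, _, _, _, _, hc, ⟨h1, h2, h3, h4⟩,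
    _⟩ := h
  constructor
  case loaded => constructor <;> simp_all [pop, Prog.run, NExp.eval, topE]
  case records =>
    exact ⟨fun l hl => h1 l (by omega), fun l hl => h2 l (by omega), fun l hl => h3 l (by omega),
      fun l hl => h4 l (by omega)⟩
  all_goals simp_all [pop, Prog.run, NExp.eval, topE]

/-- The memory after putting the `K`-th line, starting at `z`, on a stack of depth `m`. -/
noncomputable def pushed (d : Data) (σ : Store) (K m : ℕ) (z : ℝ) (c : ℕ) : Store where
  nat := Function.update σ.nat 2 (m + 1)
  real := σ.real
  natArr := Function.update σ.natArr 4 (Function.update (σ.natArr 4) m c)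
  realArr := fun r =>
    if r = 8 then Function.update (σ.realArr 8) m z
    else if r = 9 then
      Function.update (if 0 < m then Function.update (σ.realArr 9) (m - 1) z else σ.realArr 9)
        m d.δ
    else if r = 10 then Function.update (σ.realArr 10) m (d.slope K)
    else if r = 11 then Function.update (σ.realArr 11) m (d.value K)
    else σ.realArr r

theorem Active.run_push {σ : Store} {K m : ℕ} {k : ℕ → ℕ} {ξ : ℝ} {pB pC : ℕ}
    (h : d.Active σ K m k ξ pB pC) :
    push.run σ = d.pushed σ K m (if 0 < m then
      d.δ - (d.value K - d.value (k (m - 1))) / (d.slope K - d.slope (k (m - 1))) else 0)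
      (pB + pC) := by
  have hs := h.slopeE_eval
  have hv := h.valueE_eval
  have hr := h.records
  obtain ⟨⟨_, _, _, _, _, _, _, _, _, _, _, _, _⟩, _, _, _, _, _, _, _, _, hc, -, _⟩ := h
  by_cases hm : 0 < m
  · have e1 := hr.slope (m - 1) (by omega)
    have e2 := hr.value (m - 1) (by omega)
    have e3 : m - 1 ≠ m := by omega
    have e4 : 1 ≤ m := hm
    simp only [pushed, push, pushStart, Prog.run, Test.Holds, NExp.eval, RExp.eval, topE]
    simp_all [slopeE, valueE, NExp.eval, RExp.eval, Function.update]
    funext r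
    by_cases h8 : r = 8 <;> by_cases h9 : r = 9 <;> by_cases h10 : r = 10 <;>
      by_cases h11 : r = 11 <;> simp_all [Function.update]
  · obtain rfl : m = 0 := by omega
    simp only [pushed, push, pushStart, Prog.run, Test.Holds, NExp.eval, RExp.eval, topE]
    simp_all [slopeE, valueE, NExp.eval, RExp.eval, Function.update]
    funext r
    by_cases h8 : r = 8 <;> by_cases h9 : r = 9 <;> by_cases h10 : r = 10 <;>
      by_cases h11 : r = 11 <;> simp_all [Function.update]

/-- A push also sets the right end of the former top, overwriting what a record popped in the
meantime may have left there; this restores `glue`. -/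
theorem Active.pushed_records {σ : Store} {K m : ℕ} {k : ℕ → ℕ} {ξ z : ℝ} {pB pC : ℕ}
    (h : d.Active σ K m k ξ pB pC) (hB : pB = d.cB (d.path K).1) (hC : pC = d.cC (d.path K).2) :
    d.Records (d.pushed σ K m z (pB + pC)) (m + 1) (Function.update k m K) := by
  obtain ⟨h1, h2, h3, h4⟩ := h.records
  constructor
  case glue =>
    intro l hl
    have e1 : l ≠ m := by omega
    have e2 : 0 < m := by omega
    by_cases e3 : l = m - 1
    · have e4 : l + 1 = m := by omega
      subst e4
      simp [pushed]
    · have e4 : l + 1 ≠ m := by omega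
      simp [pushed, e1, e2, e3, e4, h4 l (by omega)]
  all_goals
    intro l hl
    rcases Nat.lt_succ_iff_lt_or_eq.1 hl with hl | rfl
    · have := hl.ne
      simp_all [pushed]
    · simp_all [pushed, count]

theorem Active.pushed_envelope {σ : Store} {K m : ℕ} {k : ℕ → ℕ} {ξ : ℝ} {pB pC : ℕ}
    (hd : d.Valid) (h : d.Active σ K m k ξ pB pC) (hb : ¬ beats.Holds σ) (c : ℕ) :
    Envelope d.δ d.slope d.value (K + 1) (m + 1) (Function.update k m K)
      ((d.pushed σ K m (if 0 < m then
      d.δ - (d.value K - d.value (k (m - 1))) / (d.slope K - d.slope (k (m - 1))) else 0)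
      c).realArr 8) (d.δ + 1) := by
  rw [h.beats_iff] at hb
  have he := h.envelope
  rcases m with _ | m
  · exact he.push_empty hd.δ_nonneg (by simp) (by simp [pushed])
  · have hlt := he.idx_lt m (by omega)
    refine he.push (hd.slope_mono hlt.le h.le) (hd.value_mono hlt.le h.le) ?_ ?_ ?_ ?_ ?_
    · by_contra hge
      exact hb ⟨by omega, by simpa using hge⟩
    · intro l hl
      simp [show l ≠ m + 1 by omega]
    · intro l hl
      simp [pushed, show l ≠ m + 1 by omega]
    · simp
    · simp [pushed]

theorem run_advance {σ : Store} {K : ℕ} (h : d.Loaded σ) (hK : K ≤ d.nB + d.nC)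
    (hB : σ.nat 3 = (d.path K).1) (hC : σ.nat 4 = (d.path K).2) :
    (K < d.nB + d.nC ∧ advance.run σ =
      { σ with
        nat := Function.update (Function.update σ.nat 3 (d.path (K + 1)).1) 4 (d.path (K + 1)).2 }) ∨
    (K = d.nB + d.nC ∧ advance.run σ = { σ with nat := Function.update σ.nat 7 1 }) := by
  have hsum := d.path_sum K
  have hle := path_le hK
  have hstep : d.path (K + 1) = mergeStep d.nB d.nC (fun i => (d.δ - d.eB i) * (1 - d.sB i))
    (fun j => (d.δ - d.eC j) * (1 - d.sC j)) (d.path K) := rfl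
  -- The registers 0 and 1 hold numbers of records, one more than the last indices, so adding 2 in
  -- the tests expresses that a next record exists.
  have htest : Test.Holds σ (.conj (.natLe (.add (.reg 3) (.lit 2)) (.reg 0))
      (.neg (.conj (.natLe (.add (.reg 4) (.lit 2)) (.reg 1))
        (.neg (.realLe (keyE 5 6 4) (keyE 1 2 3)))))) ↔
      (d.path K).1 < d.nB ∧ ((d.path K).2 < d.nC →
        (d.δ - d.eC (d.path K).2) * (1 - d.sC (d.path K).2) ≤
          (d.δ - d.eB (d.path K).1) * (1 - d.sB (d.path K).1)) := by
    simp only [Test.Holds, NExp.eval, RExp.eval, keyE, h.nB, h.nC, hB, hC, h.eB, h.eC, h.sB, h.sC,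
      h.δ, not_and, not_not, Nat.cast_one]
    refine and_congr (by omega) (imp_congr_left (by omega))
  unfold advance
  rw [Prog.run]
  simp only [htest]
  unfold mergeStep at hstep
  split_ifs at hstep ⊢ with h1
  · left
    refine ⟨by omega, ?_⟩
    rw [hstep]
    simp only [Prog.run, NExp.eval, hB]
    congr 1
    funext r
    by_cases h3 : r = 3 <;> by_cases h4 : r = 4 <;> simp_all
  · rw [Prog.run]
    simp only [Test.Holds, NExp.eval, h.nC, hC]
    split_ifs with h2
    · left
      refine ⟨by omega, ?_⟩
      rw [hstep]
      simp only [Prog.run, NExp.eval, hC]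
      congr 1
      funext r
      by_cases h3 : r = 3 <;> by_cases h4 : r = 4 <;> simp_all
    · right
      refine ⟨?_, by simp [Prog.run, NExp.eval]⟩
      -- If neither chain can advance, the path has reached `(nB, nC)`.
      by_contra hne
      exact h1 ⟨by omega, fun h' => absurd h' (by omega)⟩

theorem Loaded.pushed {σ : Store} (h : d.Loaded σ) (K m : ℕ) (z : ℝ) (c : ℕ) :
    d.Loaded (d.pushed σ K m z c) := by
  obtain ⟨_, _, _, _, _, _, _, _, _, _, _, _, _⟩ := h
  constructor <;> simp_all [Data.pushed]

/-- The variant drops by one each time. A copy or a pop removes one unit of pending work; a push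
adds one to the depth, but advancing `K`, weighted by 2, pays for it. After the last pair the flag
ends the loop and the variant no longer matters. -/
theorem inv_run_body (hd : d.Valid) (σ : Store) (μ : ℕ) (h : d.Inv σ μ) (hrun : running.Holds σ) :
    ∃ μ' < μ, d.Inv (body.run σ) μ' := by
  rcases h with ⟨h7, K, m, k, ξ, pB, pC, h, hμ⟩ | ⟨h7, -⟩
  swap
  · simp [running, Test.Holds, NExp.eval, h7] at hrun
  have hcB := hd.cB_mono _ _ (path_le h.le).1 le_rfl
  have hcC := hd.cC_mono _ _ (path_le h.le).2 le_rfl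
  have hle := h.le
  have hpB := h.pB_le
  have hpC := h.pC_le
  unfold body
  rw [Prog.run]
  simp only [Test.Holds, NExp.eval, h.regPB, h.regB, h.loaded.cB]
  split_ifs with h1
  · exact ⟨_, Nat.sub_one_lt (by omega : μ ≠ 0), .inl ⟨by simp [copyB, Prog.run, h7],
      K, m, k, ξ, _, _, h.run_copyB h1, by omega⟩⟩
  rw [Prog.run]
  simp only [Test.Holds, NExp.eval, h.regPC, h.regC, h.loaded.cC]
  split_ifs with h2
  · exact ⟨_, Nat.sub_one_lt (by omega : μ ≠ 0), .inl ⟨by simp [copyC, Prog.run, h7],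
      K, m, k, ξ, _, _, h.run_copyC h2, by omega⟩⟩
  rw [Prog.run]
  split_ifs with h3
  · obtain ⟨m, rfl⟩ : ∃ m', m = m' + 1 := ⟨m - 1, by have := (h.beats_iff.1 h3).1; omega⟩
    exact ⟨_, Nat.sub_one_lt (by omega : μ ≠ 0), .inl ⟨by simp [pop, Prog.run, h7],
      K, m, k, _, _, _, h.run_pop hd h3, by omega⟩⟩
  have hB : pB = d.cB (d.path K).1 := by omega
  have hC : pC = d.cC (d.path K).2 := by omega
  have hnext := h.copied.next hB hC
  have hrec := h.pushed_records (z := if 0 < m then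
      d.δ - (d.value K - d.value (k (m - 1))) / (d.slope K - d.slope (k (m - 1))) else 0) hB hC
  have henv := h.pushed_envelope hd h3 (pB + pC)
  have hload := h.loaded.pushed K m (if 0 < m then
      d.δ - (d.value K - d.value (k (m - 1))) / (d.slope K - d.slope (k (m - 1))) else 0) (pB + pC)
  rw [Prog.run, h.run_push]
  generalize (if 0 < m then
      d.δ - (d.value K - d.value (k (m - 1))) / (d.slope K - d.slope (k (m - 1))) else 0) = z at *
  refine ⟨_, Nat.sub_one_lt (by omega : μ ≠ 0), ?_⟩
  rcases run_advance hload h.le (by simpa [pushed] using h.regB) (by simpa [pushed] using h.regC)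
    with ⟨hK, e⟩ | ⟨hK, e⟩
  · left
    rw [e]
    have hpm := path_mono (d := d) (Nat.le_succ K)
    have hpl := path_le (d := d) (K := K + 1) hK
    refine ⟨by simp [pushed, h7], K + 1, m + 1, Function.update k m K, _, pB, pC,
      ⟨?_, hK, by simp, by simp, ?_, ?_, by simp [pushed], ?_, ?_, ?_, ?_, henv⟩, by omega⟩
    · obtain ⟨_, _, _, _, _, _, _, _, _, _, _, _, _⟩ := hload
      constructor <;> simp_all
    · simpa [pushed] using h.regPB
    · simpa [pushed] using h.regPC
    · exact hpB.trans (hd.cB_mono _ _ hpm.1 hpl.1)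
    · exact hpC.trans (hd.cC_mono _ _ hpm.2 hpl.2)
    · simpa [pushed] using hnext
    · exact ⟨hrec.slope, hrec.value, hrec.count, hrec.glue⟩
  · right
    rw [e]
    subst hK
    exact ⟨by simp, m, Function.update k m _, by simp [pushed],
      ⟨pB, pC, by simpa [pushed] using hnext⟩,
      ⟨hrec.slope, hrec.value, hrec.count, hrec.glue⟩, by simp [pushed], henv⟩

theorem loopFree_init : init.LoopFree := by simp [init, Prog.LoopFree]

theorem loopFree_body : body.LoopFree := by
  simp [body, Prog.LoopFree, copyB, copyC, pop, push, pushStart, advance]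

/-- The memory before the first step contains the input. -/
structure Input (d : Data) (σ : Store) : Prop where
  nB : σ.nat 0 = d.nB + 1
  nC : σ.nat 1 = d.nC + 1
  cB : σ.natArr 0 = d.cB
  lB : σ.natArr 1 = d.lB
  cC : σ.natArr 2 = d.cC
  lC : σ.natArr 3 = d.lC
  eB : σ.realArr 1 = d.eB
  sB : σ.realArr 2 = d.sB
  vB : σ.realArr 3 = d.vB
  eC : σ.realArr 5 = d.eC
  sC : σ.realArr 6 = d.sC
  vC : σ.realArr 7 = d.vC
  δ : σ.realArr 1 d.nB = d.δ

theorem Input.active {σ : Store} (h : d.Input σ) : (init.run σ).nat 7 = 0 ∧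
    d.Active (init.run σ) 0 0 id 0 0 0 := by
  obtain ⟨_, _, _, _, _, _, _, _, _, _, _, _, _⟩ := h
  refine ⟨by simp [init, Prog.run, NExp.eval], ?_⟩
  constructor
  case loaded => constructor <;> simp_all [init, Prog.run, NExp.eval, RExp.eval]
  case records => constructor <;> simp
  case copied => constructor <;> simp
  case envelope => exact Envelope.init
  all_goals simp [init, Prog.run, NExp.eval, path, mergePath]

/-- The merging program halts after a linear number of steps with the upper envelope of the lines
on the merge path in memory. -/
theorem Input.exec {σ : Store} (h : d.Input σ) (hd : d.Valid) :
    ∃ t σ' m k, Exec prog σ t σ' ∧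
      t ≤ init.maxSteps + (running.steps + 1 + body.maxSteps) *
        (2 * (d.nB + d.nC + 1) + d.cB d.nB + d.cC d.nC + 1) ∧ d.Finished σ' m k := by
  obtain ⟨t₁, ht₁, e₁⟩ := loopFree_init.exec σ
  obtain ⟨h7, hact⟩ := h.active
  obtain ⟨t₂, σ', e₂, ht₂, ⟨μ, hInv⟩, hhalt⟩ := exec_loop loopFree_body d.Inv (inv_run_body hd) _
    (init.run σ) (.inl ⟨h7, 0, 0, id, 0, 0, 0, hact, rfl⟩)
  rcases hInv with ⟨h0, -⟩ | ⟨-, m, k, hfin⟩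
  · exact absurd (by simp [running, Test.Holds, NExp.eval, h0]) hhalt
  · exact ⟨_, σ', m, k, .seq e₁ e₂, Nat.add_le_add ht₁ (by simpa using ht₂), hfin⟩

end Data

end Merge

end RealRAM

/-! ### Descriptions indexed by natural numbers -/

/-- The record with index `i`, or the last one if there is none. -/
def Description.get {T : RootedTree.{u}} (D : Description T) (i : ℕ) : PieceRecord T :=
  D.piece ⟨min i D.n, by omega⟩

theorem Description.piece_eq_get {T : RootedTree.{u}} (D : Description T) {i : ℕ} (hi : i ≤ D.n) :
    D.piece ⟨i, Nat.lt_succ_of_le hi⟩ = D.get i := by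
  simp [Description.get, hi]

theorem le_of_forall_succ_le {α : Type*} [Preorder α] {f : ℕ → α} {n : ℕ}
    (h : ∀ i < n, f i ≤ f (i + 1)) {i j : ℕ} (hij : i ≤ j) (hj : j ≤ n) : f i ≤ f j := by
  induction j, hij using Nat.le_induction with
  | base => rfl
  | succ j hij ih => exact (ih (by omega)).trans (h j (by omega))

namespace Describes

variable {T : RootedTree.{u}} [Fintype T] {P : TourProblem T} {a : T} {I : Finset T}
  {D : Description T}

theorem get_last (h : Describes P a I D) : (D.get D.n).xmax = P.dist a := by
  rw [← h.last, ← D.piece_eq_get le_rfl]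
  rfl

theorem get_glue (h : Describes P a I D) {i : ℕ} (hi : i < D.n) :
    (D.get i).xmax = (D.get (i + 1)).xmin := by
  rw [← D.piece_eq_get hi.le, ← D.piece_eq_get hi]
  exact h.glue ⟨i, hi⟩

theorem get_range (h : Describes P a I D) {i : ℕ} (hi : i ≤ D.n) :
    (D.get i).xmin ≤ (D.get i).xmax := by
  rw [← D.piece_eq_get hi]
  exact h.range _

theorem get_slope_lt_succ (h : Describes P a I D) {i : ℕ} (hi : i < D.n) :
    (D.get i).slope < (D.get (i + 1)).slope := by
  rw [← D.piece_eq_get hi.le, ← D.piece_eq_get hi]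
  exact h.slope_lt ⟨i, hi⟩

theorem get_nodes_ssubset_succ (h : Describes P a I D) {i : ℕ} (hi : i < D.n) :
    (D.get i).nodes ⊂ (D.get (i + 1)).nodes := by
  rw [← D.piece_eq_get hi.le, ← D.piece_eq_get hi]
  exact h.nodes_ssubset ⟨i, hi⟩

theorem get_slope (h : Describes P a I D) (i : ℕ) :
    (D.get i).slope = P.requestProb (D.get i).nodes := h.slope_eq _

theorem get_value (h : Describes P a I D) (i : ℕ) :
    (D.get i).value = P.profit a (D.get i).nodes (P.dist a) := h.value_eq _

theorem get_slope_le_one (h : Describes P a I D) (i : ℕ) : (D.get i).slope ≤ 1 := by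
  rw [h.get_slope]
  exact P.requestProb_le_one _

theorem get_nodes_mono (h : Describes P a I D) {i j : ℕ} (hij : i ≤ j) (hj : j ≤ D.n) :
    (D.get i).nodes ⊆ (D.get j).nodes :=
  le_of_forall_succ_le (f := fun i => (D.get i).nodes)
    (fun _ hi => (h.get_nodes_ssubset_succ hi).subset) hij hj

theorem get_slope_mono (h : Describes P a I D) {i j : ℕ} (hij : i ≤ j) (hj : j ≤ D.n) :
    (D.get i).slope ≤ (D.get j).slope :=
  le_of_forall_succ_le (f := fun i => (D.get i).slope)
    (fun _ hi => (h.get_slope_lt_succ hi).le) hij hj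

theorem get_xmax_mono (h : Describes P a I D) {i j : ℕ} (hij : i ≤ j) (hj : j ≤ D.n) :
    (D.get i).xmax ≤ (D.get j).xmax :=
  le_of_forall_succ_le (f := fun i => (D.get i).xmax)
    (fun _ hi => (h.get_glue hi).le.trans (h.get_range hi)) hij hj

theorem get_xmax_le (h : Describes P a I D) {i : ℕ} (hi : i ≤ D.n) :
    (D.get i).xmax ≤ P.dist a :=
  h.get_last ▸ h.get_xmax_mono hi le_rfl

theorem get_slope_lt_one (h : Describes P a I D) {i : ℕ} (hi : i < D.n) : (D.get i).slope < 1 :=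
  (h.get_slope_lt_succ hi).trans_le (h.get_slope_le_one _)

/-- The records cover the domain. -/
theorem exists_get (h : Describes P a I D) {x : ℝ} (hx : x ∈ Set.Icc 0 (P.dist a)) :
    ∃ i ≤ D.n, (D.get i).xmin ≤ x ∧ (i < D.n → x < (D.get i).xmax) ∧
      P.IsMaximalOptimal a I x (D.get i).nodes := by
  have key : ∀ n ≤ D.n, (∃ i < n, (D.get i).xmin ≤ x ∧ x < (D.get i).xmax) ∨
      (D.get n).xmin ≤ x := by
    intro n hn
    induction n with
    | zero => exact .inr ((h.first).le.trans hx.1)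
    | succ n ih =>
      rcases ih (by omega) with ⟨i, hi, h'⟩ | h'
      · exact .inl ⟨i, by omega, h'⟩
      · rcases lt_or_ge x (D.get n).xmax with hlt | hge
        · exact .inl ⟨n, by omega, h', hlt⟩
        · exact .inr ((h.get_glue hn).ge.trans hge)
  rcases key D.n le_rfl with ⟨i, hi, h1, h2⟩ | h1
  · exact ⟨i, hi.le, h1, fun _ => h2, h.maximal _ x ⟨h1, h2⟩⟩
  · refine ⟨D.n, le_rfl, h1, fun h2 => absurd h2 (lt_irrefl _), ?_⟩
    rcases hx.2.lt_or_eq with hlt | rfl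
    · exact h.maximal _ x ⟨h1, hlt.trans_eq h.get_last.symm⟩
    · rw [← D.piece_eq_get le_rfl]
      exact h.maximal_last

/-- Some bonus has to witness each record. The range of a record other than the last has positive
length, so `xmin` serves; the last range may be a single point, whence the right end of the domain.
-/
theorem get_isMaximalOptimal (h : Describes P a I D) {i : ℕ} (hi : i ≤ D.n) :
    P.IsMaximalOptimal a I (if i < D.n then (D.get i).xmin else P.dist a) (D.get i).nodes := by
  split_ifs with hlt
  · refine h.maximal _ _ ⟨le_rfl, ?_⟩
    have := h.xmin_lt ⟨i, hlt⟩
    rw [← h.glue ⟨i, hlt⟩] at this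
    have e : D.piece ((⟨i, hlt⟩ : Fin D.n).castSucc) = D.get i := D.piece_eq_get hi
    rwa [e] at this
  · obtain rfl : i = D.n := by omega
    rw [← D.piece_eq_get le_rfl]
    exact h.maximal_last

theorem get_nodes_subset (h : Describes P a I D) {i : ℕ} (hi : i ≤ D.n) :
    (D.get i).nodes ⊆ groupNodes a I :=
  (h.get_isMaximalOptimal hi).1.1

/-- At a bonus where the later record is optimal, its line is not below the earlier one. Being
steeper, it is still not below at the right end of the domain. -/
theorem get_value_mono (h : Describes P a I D) {i j : ℕ} (hij : i ≤ j) (hj : j ≤ D.n) :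
    (D.get i).value ≤ (D.get j).value := by
  refine le_of_forall_succ_le (f := fun i => (D.get i).value) (fun l hl => ?_) hij hj
  have hopt := (h.get_isMaximalOptimal hl).1
  have hx : (if l + 1 < D.n then (D.get (l + 1)).xmin else P.dist a) ≤ P.dist a := by
    split_ifs
    · exact (h.get_range hl).trans (h.get_xmax_le hl)
    · rfl
  generalize (if l + 1 < D.n then (D.get (l + 1)).xmin else P.dist a) = x at hopt hx
  have h1 := (P.isOptimal_iff.1 hopt).2 _ (h.get_nodes_subset hl.le)
  rw [P.profit_eq a (D.get l).nodes, P.profit_eq a (D.get (l + 1)).nodes, ← h.get_slope,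
    ← h.get_slope, ← h.get_value, ← h.get_value] at h1
  have h2 := mul_le_mul_of_nonneg_left (h.get_slope_lt_succ hl).le (sub_nonneg.2 hx)
  show (D.get l).value ≤ (D.get (l + 1)).value
  linarith

theorem le_card_get (h : Describes P a I D) {i : ℕ} (hi : i ≤ D.n) :
    i ≤ (D.get i).nodes.card := by
  induction i with
  | zero => exact Nat.zero_le _
  | succ i ih =>
    exact (ih (by omega)).trans_lt (Finset.card_lt_card (h.get_nodes_ssubset_succ hi))

/-- The merging keys are antitone. -/
theorem key_antitone (h : Describes P a I D) {i j : ℕ} (hij : i ≤ j) (hj : j < D.n) :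
    (P.dist a - (D.get j).xmax) * (1 - (D.get j).slope) ≤
      (P.dist a - (D.get i).xmax) * (1 - (D.get i).slope) :=
  mul_le_mul (sub_le_sub_left (h.get_xmax_mono hij hj.le) _)
    (sub_le_sub_left (h.get_slope_mono hij hj.le) _) (sub_nonneg.2 (h.get_slope_le_one _))
    (sub_nonneg.2 (h.get_xmax_le (hij.trans hj.le)))

end Describes

/-! ### Optimality conditions for a pair, expressed by keys. -/

/-- Comparison of the merging keys around a pair of records that is optimal for the bonus `x`. -/
theorem key_lt_key {δ x e e' s s' sn : ℝ} (hx : x ≤ δ) (hs : s ≤ sn) (hsn : sn ≤ 1)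
    (hs' : s' < 1) (h : e ≤ δ - (δ - x) * (1 - s')) (h' : δ - (δ - x) * (1 - sn) < e') :
    (δ - e') * (1 - s') < (δ - e) * (1 - s) := by
  -- Here `e` is the common end of two consecutive records of one chain, with slopes `s` and `sn`,
  -- while `e'` and `s'` belong to the current record of the other chain. Multiplying `h'` by 1 - s'
  -- and `h` by 1 - sn produces the same middle term, which eliminates `x`.
  have h1 : (δ - e') * (1 - s') < (δ - x) * (1 - sn) * (1 - s') :=
    mul_lt_mul_of_pos_right (by linarith) (by linarith)
  have h2 : (δ - x) * (1 - s') * (1 - sn) ≤ (δ - e) * (1 - sn) :=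
    mul_le_mul_of_nonneg_right (by linarith) (by linarith)
  have h3 : 0 ≤ δ - e := by nlinarith [mul_nonneg (sub_nonneg.2 hx) (sub_nonneg.2 hs'.le)]
  have h4 : (δ - e) * (1 - sn) ≤ (δ - e) * (1 - s) :=
    mul_le_mul_of_nonneg_left (by linarith) h3
  linarith

theorem bonus_mem_Icc {δ x s : ℝ} (hx : x ∈ Set.Icc 0 δ) (hs0 : 0 ≤ s) (hs : s ≤ 1) :
    δ - (δ - x) * (1 - s) ∈ Set.Icc 0 δ := by
  obtain ⟨h0, h1⟩ := hx
  constructor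
  · nlinarith [mul_nonneg (sub_nonneg.2 h1) hs0]
  · nlinarith [mul_nonneg (sub_nonneg.2 h1) (sub_nonneg.2 hs)]

/-! ### Correctness of the merge for stored descriptions. -/

namespace RealRAM

section

variable {T : RootedTree.{u}} {label : T ↪ ℕ} {σ : Store} {r : ℕ} {D : Description T}

theorem Stores.get_xmax (h : Stores label σ r D) {i : ℕ} (hi : i ≤ D.n) :
    σ.realArr (4 * r + 1) i = (D.get i).xmax := by
  rw [← D.piece_eq_get hi]; exact h.xmax ⟨i, Nat.lt_succ_of_le hi⟩

theorem Stores.get_slope (h : Stores label σ r D) {i : ℕ} (hi : i ≤ D.n) :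
    σ.realArr (4 * r + 2) i = (D.get i).slope := by
  rw [← D.piece_eq_get hi]; exact h.slope ⟨i, Nat.lt_succ_of_le hi⟩

theorem Stores.get_value (h : Stores label σ r D) {i : ℕ} (hi : i ≤ D.n) :
    σ.realArr (4 * r + 3) i = (D.get i).value := by
  rw [← D.piece_eq_get hi]; exact h.value ⟨i, Nat.lt_succ_of_le hi⟩

theorem Stores.get_card (h : Stores label σ r D) {i : ℕ} (hi : i ≤ D.n) :
    σ.natArr (2 * r) i = (D.get i).nodes.card := by
  rw [← D.piece_eq_get hi]; exact h.card ⟨i, Nat.lt_succ_of_le hi⟩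

theorem Stores.get_nodes (h : Stores label σ r D) (i : ℕ) :
    (Finset.range (D.get i).nodes.card).image (σ.natArr (2 * r + 1)) =
      (D.get i).nodes.map label := h.nodes _

end

/-- The data of two descriptions stored in memory. -/
def inputData (σ : Store) (nB nC : ℕ) (δ : ℝ) : Merge.Data where
  nB := nB
  nC := nC
  cB := σ.natArr 0
  lB := σ.natArr 1
  cC := σ.natArr 2
  lC := σ.natArr 3
  eB := σ.realArr 1
  sB := σ.realArr 2
  vB := σ.realArr 3
  eC := σ.realArr 5
  sC := σ.realArr 6
  vC := σ.realArr 7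
  δ := δ

/-- Two descriptions of disjoint groups of sub-trees in memory. -/
structure MergeSetting {T : RootedTree.{u}} [Fintype T] (P : TourProblem T) (a : T)
    (B C : Finset T) (DB DC : Description T) (label : T ↪ ℕ) (σ : Store) : Prop where
  disjoint : Disjoint B C
  descB : Describes P a B DB
  descC : Describes P a C DC
  storesB : Stores label σ 0 DB
  storesC : Stores label σ 1 DC

namespace MergeSetting

variable {T : RootedTree.{u}} [Fintype T] {P : TourProblem T} {a : T} {B C : Finset T}
  {DB DC : Description T} {label : T ↪ ℕ} {σ : Store}

theorem input (h : MergeSetting P a B C DB DC label σ) :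
    (inputData σ DB.n DC.n (P.dist a)).Input σ := by
  constructor
  case nB => exact h.storesB.count
  case nC => exact h.storesC.count
  -- The length of the domain is no separate input; it is the right end of the last record.
  case δ => exact (h.storesB.get_xmax le_rfl).trans h.descB.get_last
  all_goals rfl

theorem valid (h : MergeSetting P a B C DB DC label σ) :
    (inputData σ DB.n DC.n (P.dist a)).Valid where
  cB_mono i j hij hj := by
    have e1 := h.storesB.get_card (hij.trans hj)
    have e2 := h.storesB.get_card hj
    exact (e1.trans_le (Finset.card_le_card (h.descB.get_nodes_mono hij hj))).trans_eq e2.symm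
  cC_mono i j hij hj := by
    have e1 := h.storesC.get_card (hij.trans hj)
    have e2 := h.storesC.get_card hj
    exact (e1.trans_le (Finset.card_le_card (h.descC.get_nodes_mono hij hj))).trans_eq e2.symm
  sB_mono i j hij hj := by
    have e1 := h.storesB.get_slope (hij.trans hj)
    have e2 := h.storesB.get_slope hj
    exact (e1.trans_le (h.descB.get_slope_mono hij hj)).trans_eq e2.symm
  sC_mono i j hij hj := by
    have e1 := h.storesC.get_slope (hij.trans hj)
    have e2 := h.storesC.get_slope hj
    exact (e1.trans_le (h.descC.get_slope_mono hij hj)).trans_eq e2.symm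
  vB_mono i j hij hj := by
    have e1 := h.storesB.get_value (hij.trans hj)
    have e2 := h.storesB.get_value hj
    exact (e1.trans_le (h.descB.get_value_mono hij hj)).trans_eq e2.symm
  vC_mono i j hij hj := by
    have e1 := h.storesC.get_value (hij.trans hj)
    have e2 := h.storesC.get_value hj
    exact (e1.trans_le (h.descC.get_value_mono hij hj)).trans_eq e2.symm
  sB_le i hi := (h.storesB.get_slope hi).trans_le (h.descB.get_slope_le_one i)
  sC_le i hi := (h.storesC.get_slope hi).trans_le (h.descC.get_slope_le_one i)
  δ_nonneg := P.dist_nonneg a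

open Classical in
/-- The node set of the `K`-th pair on the merge path. -/
noncomputable def pairNodes (P : TourProblem T) (a : T) (DB DC : Description T) (σ : Store)
    (K : ℕ) : Finset T :=
  (DB.get ((inputData σ DB.n DC.n (P.dist a)).path K).1).nodes ∪
    (DC.get ((inputData σ DB.n DC.n (P.dist a)).path K).2).nodes

variable (h : MergeSetting P a B C DB DC label σ)
include h

theorem pair_disjoint {i j : ℕ} (hi : i ≤ DB.n) (hj : j ≤ DC.n) :
    Disjoint (DB.get i).nodes (DC.get j).nodes :=
  Finset.disjoint_of_subset_left (h.descB.get_nodes_subset hi)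
    (Finset.disjoint_of_subset_right (h.descC.get_nodes_subset hj)
      (TourProblem.groupNodes_disjoint a h.disjoint))

theorem requestProb_pairNodes {K : ℕ} (hK : K ≤ DB.n + DC.n) :
    P.requestProb (pairNodes P a DB DC σ K) =
      (inputData σ DB.n DC.n (P.dist a)).slope K := by
  classical
  have hle := Merge.Data.path_le (d := inputData σ DB.n DC.n (P.dist a)) hK
  have e1 := h.storesB.get_slope hle.1
  have e2 := h.storesC.get_slope hle.2
  rw [pairNodes, P.requestProb_union (h.pair_disjoint hle.1 hle.2), ← h.descB.get_slope,
    ← h.descC.get_slope, ← e1, ← e2]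
  rfl

theorem profit_pairNodes {K : ℕ} (hK : K ≤ DB.n + DC.n) (x : ℝ) :
    P.profit a (pairNodes P a DB DC σ K) x = lineAt (P.dist a)
      ((inputData σ DB.n DC.n (P.dist a)).slope K)
      ((inputData σ DB.n DC.n (P.dist a)).value K) x := by
  classical
  have hle := Merge.Data.path_le (d := inputData σ DB.n DC.n (P.dist a)) hK
  have e1 := h.storesB.get_value hle.1
  have e2 := h.storesC.get_value hle.2
  rw [P.profit_eq, h.requestProb_pairNodes hK, pairNodes,
    P.profit_union_dist h.disjoint (h.descB.get_nodes_subset hle.1)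
      (h.descC.get_nodes_subset hle.2), ← h.descB.get_value, ← h.descC.get_value, ← e1, ← e2]
  rfl

theorem pairNodes_mono {K K' : ℕ} (hK : K ≤ K') (hK' : K' ≤ DB.n + DC.n) :
    pairNodes P a DB DC σ K ⊆ pairNodes P a DB DC σ K' := by
  classical
  have hle := Merge.Data.path_le (d := inputData σ DB.n DC.n (P.dist a)) hK'
  have hm := Merge.Data.path_mono (d := inputData σ DB.n DC.n (P.dist a)) hK
  exact Finset.union_subset_union (h.descB.get_nodes_mono hm.1 hle.1)
    (h.descC.get_nodes_mono hm.2 hle.2)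

theorem card_pairNodes {K : ℕ} (hK : K ≤ DB.n + DC.n) :
    (pairNodes P a DB DC σ K).card = (inputData σ DB.n DC.n (P.dist a)).count K := by
  classical
  have hle := Merge.Data.path_le (d := inputData σ DB.n DC.n (P.dist a)) hK
  have e1 := h.storesB.get_card hle.1
  have e2 := h.storesC.get_card hle.2
  rw [pairNodes, Finset.card_union_of_disjoint (h.pair_disjoint hle.1 hle.2), ← e1, ← e2]
  rfl

variable {I : Finset T} (hI : ∀ v, v ∈ groupNodes a I ↔ v ∈ groupNodes a B ∨ v ∈ groupNodes a C)
include hI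

/-- The maximal optimal sets of the union of the groups are on the merge path. -/
theorem exists_pairNodes {x : ℝ} (hx : x ∈ Set.Icc 0 (P.dist a)) :
    ∃ K ≤ DB.n + DC.n, P.IsMaximalOptimal a I x (pairNodes P a DB DC σ K) := by
  classical
  obtain ⟨M, hM⟩ := P.exists_isMaximalOptimal a I x
  obtain ⟨S, S', hS, hS', rfl⟩ : ∃ S S', S ⊆ groupNodes a B ∧ S' ⊆ groupNodes a C ∧ M = S ∪ S' := by
    refine ⟨M ∩ groupNodes a B, M ∩ groupNodes a C, Finset.inter_subset_right,
      Finset.inter_subset_right, ?_⟩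
    rw [← Finset.inter_union_distrib_left, eq_comm, Finset.inter_eq_left]
    exact fun v hv => Finset.mem_union.2 ((hI v).1 (hM.1.1 hv))
  have hu : groupNodes a I = groupNodes a B ∪ groupNodes a C := by
    ext v
    rw [hI, Finset.mem_union]
  have hu' : groupNodes a I = groupNodes a C ∪ groupNodes a B := by rw [hu, Finset.union_comm]
  have hM' := hM
  rw [Finset.union_comm] at hM'
  have hSm := TourProblem.IsMaximalOptimal.left P h.disjoint hu hS hS' (by convert hM)
  have hSm' := TourProblem.IsMaximalOptimal.left P h.disjoint.symm hu' hS' hS (by convert hM')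
  have hx1 := bonus_mem_Icc hx (P.requestProb_nonneg S') (P.requestProb_le_one S')
  have hx2 := bonus_mem_Icc hx (P.requestProb_nonneg S) (P.requestProb_le_one S)
  obtain ⟨i, hi, hi1, hi2, him⟩ := h.descB.exists_get hx1
  obtain ⟨j, hj, hj1, hj2, hjm⟩ := h.descC.exists_get hx2
  -- By uniqueness of maximal optimal sets, the two parts are the node sets of the records `i` and
  -- `j` that cover the raised bonuses.
  obtain rfl := TourProblem.IsMaximalOptimal.unique P hx1.2 hSm him
  obtain rfl := TourProblem.IsMaximalOptimal.unique P hx2.2 hSm' hjm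
  rw [← h.descC.get_slope] at hi1 hi2
  rw [← h.descB.get_slope] at hj1 hj2
  refine ⟨i + j, Nat.add_le_add hi hj, ?_⟩
  have hpath : (inputData σ DB.n DC.n (P.dist a)).path (i + j) = (i, j) := by
    have eB : ∀ l ≤ DB.n, σ.realArr 1 l = (DB.get l).xmax := fun l hl => h.storesB.get_xmax hl
    have eC : ∀ l ≤ DC.n, σ.realArr 5 l = (DC.get l).xmax := fun l hl => h.storesC.get_xmax hl
    have sB : ∀ l ≤ DB.n, σ.realArr 2 l = (DB.get l).slope := fun l hl => h.storesB.get_slope hl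
    have sC : ∀ l ≤ DC.n, σ.realArr 6 l = (DC.get l).slope := fun l hl => h.storesC.get_slope hl
    refine mergePath_eq hi hj ?_ ?_ ?_ ?_ <;> simp only [inputData]
    · intro l l' hl hl'
      rw [eB l (hl.trans hl'.le), eB l' hl'.le, sB l (hl.trans hl'.le), sB l' hl'.le]
      exact h.descB.key_antitone hl hl'
    · intro l l' hl hl'
      rw [eC l (hl.trans hl'.le), eC l' hl'.le, sC l (hl.trans hl'.le), sC l' hl'.le]
      exact h.descC.key_antitone hl hl'
    · rintro l rfl hlt
      rw [eC j hj, sC j hj, eB l (by omega), sB l (by omega)]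
      refine key_lt_key hx.2 (h.descB.get_slope_lt_succ hi).le (h.descB.get_slope_le_one _)
        (h.descC.get_slope_lt_one hlt) ?_ (hj2 hlt)
      rwa [h.descB.get_glue hi]
    · rintro l rfl hlt
      rw [eB i hi, sB i hi, eC l (by omega), sC l (by omega)]
      refine key_lt_key hx.2 (h.descC.get_slope_lt_succ hj).le (h.descC.get_slope_le_one _)
        (h.descB.get_slope_lt_one hlt) ?_ (hi2 hlt)
      rwa [h.descC.get_glue hj]
  rw [pairNodes, hpath]
  convert hM

/-- The last of the maximal lines on the merge path belongs to the maximal optimal set. -/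
theorem isMaximalOptimal_pairNodes {x : ℝ} (hx : x ∈ Set.Icc 0 (P.dist a)) {K : ℕ}
    (hK : K ≤ DB.n + DC.n)
    (hmax : ∀ K' < DB.n + DC.n + 1,
      lineAt (P.dist a) ((inputData σ DB.n DC.n (P.dist a)).slope K')
        ((inputData σ DB.n DC.n (P.dist a)).value K') x ≤
      lineAt (P.dist a) ((inputData σ DB.n DC.n (P.dist a)).slope K)
        ((inputData σ DB.n DC.n (P.dist a)).value K) x ∧
      (K < K' → lineAt (P.dist a) ((inputData σ DB.n DC.n (P.dist a)).slope K')
        ((inputData σ DB.n DC.n (P.dist a)).value K') x <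
      lineAt (P.dist a) ((inputData σ DB.n DC.n (P.dist a)).slope K)
        ((inputData σ DB.n DC.n (P.dist a)).value K) x)) :
    P.IsMaximalOptimal a I x (pairNodes P a DB DC σ K) := by
  classical
  obtain ⟨K', hK', hM⟩ := h.exists_pairNodes hI hx
  have hsub : pairNodes P a DB DC σ K ⊆ groupNodes a I := by
    have hle := Merge.Data.path_le (d := inputData σ DB.n DC.n (P.dist a)) hK
    intro v hv
    rw [pairNodes, Finset.mem_union] at hv
    exact (hI v).2 (hv.imp (fun h' => h.descB.get_nodes_subset hle.1 h')
      fun h' => h.descC.get_nodes_subset hle.2 h')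
  have hle := (P.isOptimal_iff.1 hM.1).2 _ hsub
  rw [h.profit_pairNodes hK, h.profit_pairNodes hK'] at hle
  -- A line after `K` is strictly lower and cannot be optimal. So the maximal optimal set comes no
  -- later than `K`, is contained in the set of `K`, and equals it by maximality.
  have hKK : K' ≤ K := by
    by_contra hlt
    exact absurd hle (not_le.2 ((hmax K' (by omega)).2 (by omega)))
  have hopt : P.IsOptimal a I x (pairNodes P a DB DC σ K) := by
    refine ⟨hsub, ?_⟩
    rw [← hM.1.2, h.profit_pairNodes hK, h.profit_pairNodes hK']
    exact le_antisymm hle (hmax K' (by omega)).1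
  rwa [← hM.eq_of_le hopt (h.pairNodes_mono hKK hK)]

end MergeSetting

/-- The description read off the output memory. -/
noncomputable def outputDescription {T : RootedTree.{u}} [Fintype T] (P : TourProblem T) (a : T)
    (DB DC : Description T) (σ σ' : Store) (m : ℕ) (k : ℕ → ℕ) : Description T where
  n := m
  piece l :=
    { nodes := MergeSetting.pairNodes P a DB DC σ (k l)
      xmin := σ'.realArr 8 l
      xmax := σ'.realArr 9 l
      slope := σ'.realArr 10 l
      value := σ'.realArr 11 l }

namespace MergeSetting

variable {T : RootedTree.{u}} [Fintype T] {P : TourProblem T} {a : T} {B C : Finset T}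
  {DB DC : Description T} {label : T ↪ ℕ} {σ : Store}

theorem describes_output (h : MergeSetting P a B C DB DC label σ) {I : Finset T}
    (hI : ∀ v, v ∈ groupNodes a I ↔ v ∈ groupNodes a B ∨ v ∈ groupNodes a C)
    {σ' : Store} {m : ℕ} {k : ℕ → ℕ}
    (hf : (inputData σ DB.n DC.n (P.dist a)).Finished σ' m k) :
    Describes P a I (outputDescription P a DB DC σ σ' m k) := by
  have he := hf.envelope
  have hidx : ∀ l < m + 1, k l ≤ DB.n + DC.n := fun l hl => Nat.le_of_lt_succ (he.idx_lt l hl)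
  have hreg : ∀ l < m + 1, ∀ y, σ'.realArr 8 l ≤ y → y ≤ P.dist a →
      (l + 1 < m + 1 → y < σ'.realArr 8 (l + 1)) →
      P.IsMaximalOptimal a I y (pairNodes P a DB DC σ (k l)) := fun l hl y h1 h2 h3 =>
    h.isMaximalOptimal_pairNodes hI ⟨(he.start_le l hl).trans h1, h2⟩ (hidx l hl)
      (he.region l hl y h1 h2 h3 fun _ => h2.trans_lt (lt_add_one _))
  have hslope : ∀ l < m + 1, σ'.realArr 10 l = P.requestProb (pairNodes P a DB DC σ (k l)) :=
    fun l hl => (hf.records.slope l hl).trans (h.requestProb_pairNodes (hidx l hl)).symm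
  have hxmax : ∀ l < m + 1, σ'.realArr 9 l ≤ P.dist a := by
    intro l hl
    rcases Nat.lt_or_ge l m with hlt | hge
    · rw [hf.records.glue l (by omega)]
      exact he.le_end _ (by omega)
    · obtain rfl : l = m := by omega
      exact hf.last.le
  constructor
  case first => exact he.start (by omega)
  case last => exact hf.last
  case range =>
    rintro ⟨l, hl⟩
    change l < m + 1 at hl
    change σ'.realArr 8 l ≤ σ'.realArr 9 l
    rcases Nat.lt_or_ge l m with hlt | hge
    · rw [hf.records.glue l (by omega)]
      exact (he.lt_succ l (by omega)).1.le
    · obtain rfl : l = m := by omega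
      rw [hf.last]
      exact he.le_end _ (by omega)
  case glue =>
    rintro ⟨l, hl⟩
    exact hf.records.glue l (Nat.succ_lt_succ hl)
  case xmin_lt =>
    rintro ⟨l, hl⟩
    exact (he.lt_succ l (Nat.succ_lt_succ hl)).1
  case slope_lt =>
    rintro ⟨l, hl⟩
    change l < m at hl
    change σ'.realArr 10 l < σ'.realArr 10 (l + 1)
    rw [hf.records.slope l (by omega), hf.records.slope (l + 1) (by omega)]
    exact (he.lt_succ l (by omega)).2.2
  case nodes_ssubset =>
    rintro ⟨l, hl⟩
    change l < m at hl
    change pairNodes P a DB DC σ (k l) ⊂ pairNodes P a DB DC σ (k (l + 1))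
    have hlt := he.lt_succ l (by omega)
    -- Inclusion holds along the whole path; strictness follows because equal sets would have equal
    -- slopes.
    refine (h.pairNodes_mono hlt.2.1.le (hidx _ (by omega))).ssubset_of_ne fun heq => ?_
    have h3 := hlt.2.2
    rw [← h.requestProb_pairNodes (hidx l (by omega)),
      ← h.requestProb_pairNodes (hidx (l + 1) (by omega)), heq] at h3
    exact lt_irrefl _ h3
  case maximal =>
    rintro ⟨l, hl⟩ x ⟨hx1, hx2⟩
    change l < m + 1 at hl
    change x < σ'.realArr 9 l at hx2
    refine hreg l hl x hx1 (hx2.le.trans (hxmax l hl)) fun hlt => ?_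
    rwa [← hf.records.glue l hlt]
  case maximal_last =>
    exact hreg m (by omega) _ (he.le_end m (by omega)) le_rfl fun hlt => absurd hlt (lt_irrefl _)
  case slope_eq =>
    rintro ⟨l, hl⟩
    exact hslope l hl
  case value_eq =>
    rintro ⟨l, hl⟩
    refine (hf.records.value l hl).trans ?_
    change _ = P.profit a (pairNodes P a DB DC σ (k l)) (P.dist a)
    rw [h.profit_pairNodes (hidx l hl)]
    simp [lineAt]

theorem stores_output (h : MergeSetting P a B C DB DC label σ) {σ' : Store} {m : ℕ} {k : ℕ → ℕ}
    (hf : (inputData σ DB.n DC.n (P.dist a)).Finished σ' m k) :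
    Stores label σ' 2 (outputDescription P a DB DC σ σ' m k) := by
  have hidx : ∀ l < m + 1, k l ≤ DB.n + DC.n := fun l hl =>
    Nat.le_of_lt_succ (hf.envelope.idx_lt l hl)
  constructor
  case count => exact hf.depth
  case xmin => exact fun _ => rfl
  case xmax => exact fun _ => rfl
  case slope => exact fun _ => rfl
  case value => exact fun _ => rfl
  case card =>
    rintro ⟨l, hl⟩
    exact (hf.records.count l hl).trans (h.card_pairNodes (hidx l hl)).symm
  case nodes =>
    rintro ⟨l, hl⟩
    change (Finset.range (pairNodes P a DB DC σ (k l)).card).image (σ'.natArr 5) =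
      (pairNodes P a DB DC σ (k l)).map label
    -- The prefix property is known for every pair passed by the merge, in particular for those left
    -- on the stack.
    obtain ⟨pB, pC, hc⟩ := hf.copied
    have hle := Merge.Data.path_le (d := inputData σ DB.n DC.n (P.dist a)) (hidx l hl)
    have e1 := h.storesB.get_card hle.1
    have e2 := h.storesC.get_card hle.2
    have e3 := h.storesB.get_nodes ((inputData σ DB.n DC.n (P.dist a)).path (k l)).1
    have e4 := h.storesC.get_nodes ((inputData σ DB.n DC.n (P.dist a)).path (k l)).2
    rw [← e1] at e3
    rw [← e2] at e4
    classical
    rw [h.card_pairNodes (hidx l hl), hc.image_lt _ (hf.envelope.idx_lt l hl), pairNodes,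
      Finset.map_union, ← e3, ← e4]
    rfl

/-- The size of the input is bounded by the number of nodes. -/
theorem size_le (h : MergeSetting P a B C DB DC label σ) {I : Finset T}
    (hI : ∀ v, v ∈ groupNodes a I ↔ v ∈ groupNodes a B ∨ v ∈ groupNodes a C) :
    2 * (DB.n + DC.n + 1) + σ.natArr 0 DB.n + σ.natArr 2 DC.n + 1 ≤
      3 * ((groupNodes a I).card + 1) := by
  classical
  have hu : groupNodes a I = groupNodes a B ∪ groupNodes a C := by
    ext v
    rw [hI, Finset.mem_union]
  rw [hu, Finset.card_union_of_disjoint (TourProblem.groupNodes_disjoint a h.disjoint)]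
  have e1 : σ.natArr 0 DB.n = _ := h.storesB.get_card le_rfl
  have e2 : σ.natArr 2 DC.n = _ := h.storesC.get_card le_rfl
  have h1 := Finset.card_le_card (h.descB.get_nodes_subset le_rfl)
  have h2 := Finset.card_le_card (h.descC.get_nodes_subset le_rfl)
  -- In each chain the last index is at most the size of the last set, hence at most the number of
  -- nodes of the group. Counted twice, and added to the size of that set, it gives the factor 3.
  have h3 := h.descB.le_card_get le_rfl
  have h4 := h.descC.le_card_get le_rfl
  omega

end MergeSetting

end RealRAM

theorem mainTheorem2 :
    ∃ (merge : RealRAM.Prog) (c : ℕ),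
      ∀ (T : RootedTree.{u}) [Fintype T] [DecidableEq T] (P : TourProblem T) (a : T)
        (B C : Finset T), (B : Set T) ⊆ subTreeIndices a → (C : Set T) ⊆ subTreeIndices a →
        Disjoint B C →
      ∀ (DB DC : Description T), Describes P a B DB → Describes P a C DC →
      ∀ (label : T ↪ ℕ) (σ : RealRAM.Store),
        RealRAM.Stores label σ 0 DB → RealRAM.Stores label σ 1 DC →
      ∃ (t : ℕ) (σ' : RealRAM.Store) (D : Description T),
        RealRAM.Exec merge σ t σ' ∧
        t ≤ c * ((groupNodes a (B ∪ C)).card + 1) ∧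
        Describes P a (B ∪ C) D ∧
        RealRAM.Stores label σ' 2 D := by
  -- The cost of the initialization, plus the cost of one pass of the loop times the factor 3 from
  -- `size_le`.
  refine ⟨RealRAM.Merge.prog, RealRAM.Merge.init.maxSteps +
    (RealRAM.Merge.running.steps + 1 + RealRAM.Merge.body.maxSteps) * 3, ?_⟩
  intro T _ _ P a B C _ _ hBC DB DC hB hC label σ hsB hsC
  have h : RealRAM.MergeSetting P a B C DB DC label σ := ⟨hBC, hB, hC, hsB, hsC⟩
  have hI : ∀ v, v ∈ groupNodes a (B ∪ C) ↔ v ∈ groupNodes a B ∨ v ∈ groupNodes a C := by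
    intro v
    simp only [TourProblem.mem_groupNodes, Finset.mem_union, or_and_right, exists_or]
  obtain ⟨t, σ', m, k, hex, ht, hf⟩ := h.input.exec h.valid
  refine ⟨t, σ', RealRAM.outputDescription P a DB DC σ σ' m k, hex, ht.trans ?_,
    h.describes_output hI hf, h.stores_output hf⟩
  rw [add_mul _ _ ((groupNodes a (B ∪ C)).card + 1), mul_assoc]
  exact Nat.add_le_add (Nat.le_mul_of_pos_right _ (Nat.succ_pos _))
    (Nat.mul_le_mul_left _ (h.size_le hI))
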